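/- Let $n\ge 3$, let $M$ be a compact smooth $n$-dimensional manifold with (possibly empty) smooth boundary $\partial M$, and let $g$ be a smooth Riemannian metric on $M$, with volume measure $dv_g$ and induced boundary measure $d\sigma_g$. Let $R_g$ be the scalar curvature of $g$, let $\Delta_g=-\operatorname{div}_g\nabla_g$ be the positive Laplacian, let $\nu$ be the outward unit normal along $\partial M$, and let $h_g=\operatorname{tr}_g II$ be the mean curvature of $\partial M$, where $II(X,Y)=g(\nabla_X\nu,Y)$ for $X,Y$ tangent to $\partial M$. Let $\ker P_{1,g}^R$ be the set of functions $u\in C^2(M)$ (twice continuously differentiable up to the boundary) such that $$P_{1,g}u=\Delta_g u+\frac{n-2}{4(n-1)}R_g u=0 \ \text{ on } M,\qquad B_g u=\partial_\nu u+\frac{n-2}{2(n-1)}h_g u=0\ \text{ on } \partial M .$$ Then for every $u\in\ker P_{1,g}^R$ the functions $R_g u$ and $h_g u$ are integrable over $M$ and $\partial M$ respectively, and $$\frac{n-2}{4(n-1)}\int_M R_g\,u\,dv_g+\frac{n-2}{2(n-1)}\int_{\partial M}h_g\,u\,d\sigma_g=0 .$$ -/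

import Mathlib

open Bundle Set MeasureTheory
open scoped Manifold ContDiff

noncomputable section

namespace ConformalRobin

/-- The coordinate space `ℝⁿ`; the model half-space is `{y : y₀ ≥ 0}` inside it. -/
abbrev Coord (n : ℕ) : Type := EuclideanSpace ℝ (Fin n)

/-- Smooth Riemannian metrics on the smooth `n`-manifold with boundary `M`. -/
abbrev Metric (n : ℕ) [NeZero n] (M : Type*) [TopologicalSpace M]
    [ChartedSpace (EuclideanHalfSpace n) M] [IsManifold (𝓡∂ n) ∞ M] :=
  ContMDiffRiemannianMetric (𝓡∂ n) ∞ (Coord n) (fun x : M ↦ TangentSpace (𝓡∂ n) x)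

/-- The partial derivative `∂ᵢ f` at `y`, one-sided at points of the hyperplane `y₀ = 0`. -/
def pd {n : ℕ} [NeZero n] (i : Fin n) (f : Coord n → ℝ) (y : Coord n) : ℝ :=
  fderivWithin ℝ f (range (𝓡∂ n)) y (EuclideanSpace.single i 1)

/-- The embedding of `ℝⁿ⁻¹` (indexed by the tangential indices `i ≠ 0`) into `ℝⁿ` as the
hyperplane `y₀ = 0`. -/
def bdryIncl {n : ℕ} [NeZero n] (z : {i : Fin n // i ≠ 0} → ℝ) : Coord n :=
  WithLp.toLp 2 fun i ↦ if h : i = 0 then 0 else z ⟨i, h⟩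

section

variable {n : ℕ} [NeZero n] {M : Type*} [TopologicalSpace M]
  [ChartedSpace (EuclideanHalfSpace n) M] [IsManifold (𝓡∂ n) ∞ M]

/-! In what follows, `x : M` selects the preferred chart `φ` around `x`, and `y` is a point of its
coordinate domain. -/

/-- The matrix `g_{ij}(y) = g(∂ᵢ, ∂ⱼ)`, where `∂ᵢ = d(φ⁻¹)_y eᵢ`. -/
def gram (g : Metric n M) (x : M) (y : Coord n) : Matrix (Fin n) (Fin n) ℝ :=
  Matrix.of fun i j ↦ g.inner ((extChartAt (𝓡∂ n) x).symm y)
    (mfderivWithin 𝓘(ℝ, Coord n) (𝓡∂ n) (extChartAt (𝓡∂ n) x).symm (range (𝓡∂ n)) y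
      (EuclideanSpace.single i (1 : ℝ)))
    (mfderivWithin 𝓘(ℝ, Coord n) (𝓡∂ n) (extChartAt (𝓡∂ n) x).symm (range (𝓡∂ n)) y
      (EuclideanSpace.single j (1 : ℝ)))

/-- The tangential block `(g_{ab})_{a, b ≠ 0}`; at `y₀ = 0` it is the metric induced on `∂M`. -/
def gramTan (g : Metric n M) (x : M) (y : Coord n) :
    Matrix {i : Fin n // i ≠ 0} {i : Fin n // i ≠ 0} ℝ :=
  (gram g x y).submatrix Subtype.val Subtype.val

/-- The Christoffel symbols `Γᵏᵢⱼ = ½ gᵏˡ (∂ᵢ gⱼₗ + ∂ⱼ gᵢₗ - ∂ₗ gᵢⱼ)`. -/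
def christoffel (g : Metric n M) (x : M) (k i j : Fin n) (y : Coord n) : ℝ :=
  (1 / 2) * ∑ l, (gram g x y)⁻¹ k l *
    (pd i (fun z ↦ gram g x z j l) y + pd j (fun z ↦ gram g x z i l) y
      - pd l (fun z ↦ gram g x z i j) y)

/-- The Ricci tensor
`Ricⱼₖ = ∂ᵢ Γⁱⱼₖ - ∂ₖ Γⁱⱼᵢ + Γⁱᵢₗ Γˡⱼₖ - Γⁱₖₗ Γˡⱼᵢ` (positive on round spheres). -/
def ricci (g : Metric n M) (x : M) (j k : Fin n) (y : Coord n) : ℝ :=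
  ∑ i, (pd i (christoffel g x i j k) y - pd k (christoffel g x i j i) y
    + ∑ l, (christoffel g x i i l y * christoffel g x l j k y
      - christoffel g x i k l y * christoffel g x l j i y))

/-- The scalar curvature `R_g = gʲᵏ Ricⱼₖ`. -/
def scalarCurvature (g : Metric n M) (x : M) : ℝ :=
  ∑ j, ∑ k, (gram g x (extChartAt (𝓡∂ n) x x))⁻¹ j k * ricci g x j k (extChartAt (𝓡∂ n) x x)

/-- The positive Laplacian `Δ_g u = -(det g)^{-1/2} ∂ᵢ ((det g)^{1/2} gⁱʲ ∂ⱼ u)`. -/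
def laplacian (g : Metric n M) (u : M → ℝ) (x : M) : ℝ :=
  -((√(gram g x (extChartAt (𝓡∂ n) x x)).det)⁻¹ *
    ∑ i, pd i (fun y ↦ √(gram g x y).det *
      ∑ j, (gram g x y)⁻¹ i j * pd j (u ∘ (extChartAt (𝓡∂ n) x).symm) y)
      (extChartAt (𝓡∂ n) x x))

/-- The conformal Laplacian `P_{1,g} u = Δ_g u + (n-2)/(4(n-1)) R_g u`. -/
def conformalLaplacian (g : Metric n M) (u : M → ℝ) (x : M) : ℝ :=
  laplacian g u x + ((n : ℝ) - 2) / (4 * ((n : ℝ) - 1)) * scalarCurvature g x * u x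

/-- The components `νⁱ = -gⁱ⁰ / (g⁰⁰)^{1/2}` of the outward unit normal at a point `x ∈ ∂M`
(the manifold lies in `y₀ ≥ 0`). -/
def normal (g : Metric n M) (x : M) (i : Fin n) : ℝ :=
  -((gram g x (extChartAt (𝓡∂ n) x x))⁻¹ i 0 / √((gram g x (extChartAt (𝓡∂ n) x x))⁻¹ 0 0))

/-- The outward normal derivative `∂_ν u` at `x ∈ ∂M`. -/
def normalDeriv (g : Metric n M) (u : M → ℝ) (x : M) : ℝ :=
  ∑ i, normal g x i * pd i (u ∘ (extChartAt (𝓡∂ n) x).symm) (extChartAt (𝓡∂ n) x x)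

/-- The second fundamental form with respect to the outward unit normal at `x ∈ ∂M`:
`II_{ab} = g(∇ₐ ν, ∂_b) = -g(∇ₐ ∂_b, ν) = -Γᵏ_{ab} g_{kl} νˡ` for tangential `a, b`.
With this sign the unit sphere, as boundary of the unit ball, has `II` equal to its metric. -/
def secondFundamentalForm (g : Metric n M) (x : M) (a b : {i : Fin n // i ≠ 0}) : ℝ :=
  -∑ k, ∑ l, christoffel g x k a b (extChartAt (𝓡∂ n) x x) *
    gram g x (extChartAt (𝓡∂ n) x x) k l * normal g x l

/-- The mean curvature `h_g = tr_g II` of the boundary, at `x ∈ ∂M`. -/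
def meanCurvature (g : Metric n M) (x : M) : ℝ :=
  ∑ a, ∑ b, (gramTan g x (extChartAt (𝓡∂ n) x x))⁻¹ a b * secondFundamentalForm g x a b

/-- The boundary operator `B_g u = ∂_ν u + (n-2)/(2(n-1)) h_g u`, at `x ∈ ∂M`. -/
def boundaryOp (g : Metric n M) (u : M → ℝ) (x : M) : ℝ :=
  normalDeriv g u x + ((n : ℝ) - 2) / (2 * ((n : ℝ) - 1)) * meanCurvature g x * u x

/-- The kernel of `P_{1,g}` with the conformal Robin boundary condition: the classical solutions,
twice continuously differentiable up to the boundary, of `P_{1,g} u = 0` in `M`, `B_g u = 0`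
on `∂M`. -/
def kerRobin (g : Metric n M) : Set (M → ℝ) :=
  {u | ContMDiff (𝓡∂ n) 𝓘(ℝ, ℝ) 2 u ∧ (∀ x : M, conformalLaplacian g u x = 0) ∧
    ∀ x ∈ (𝓡∂ n).boundary M, boundaryOp g u x = 0}

variable [MeasurableSpace M]

/-- The measure `(det g)^{1/2} dy` on the chart domain around `x`, carried to `M`. -/
def chartVolume (g : Metric n M) (x : M) : Measure M :=
  ((volume.restrict (extChartAt (𝓡∂ n) x).target).withDensity
    fun y ↦ ENNReal.ofReal √(gram g x y).det).map (extChartAt (𝓡∂ n) x).symm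

/-- The Riemannian volume measure `dv_g`. The measures `chartVolume g x` agree on overlaps of
charts, so their supremum is the measure that restricts to each of them on its chart domain. -/
def volumeMeasure (g : Metric n M) : Measure M := ⨆ x : M, chartVolume g x

/-- The measure `(det g_{ab})^{1/2} dz` on the boundary part (`y₀ = 0`) of the chart domain
around `x`, carried to `M`. -/
def chartArea (g : Metric n M) (x : M) : Measure M :=
  (((volume : Measure ({i : Fin n // i ≠ 0} → ℝ)).restrict
      (bdryIncl ⁻¹' (extChartAt (𝓡∂ n) x).target)).withDensity
    fun z ↦ ENNReal.ofReal √(gramTan g x (bdryIncl z)).det).map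
      fun z ↦ (extChartAt (𝓡∂ n) x).symm (bdryIncl z)

/-- The Riemannian measure `dσ_g` of the boundary, as a measure on `M` concentrated on `∂M`;
again the measures `chartArea g x` agree on overlaps. -/
def boundaryMeasure (g : Metric n M) : Measure M := ⨆ x : M, chartArea g x

end

end ConformalRobin

end

/-!
Both coefficients `(n - 2) / (4 (n - 1))` and `(n - 2) / (2 (n - 1))` are nonzero for `n ≥ 3`, so for
`u` in the kernel `R_g u` is a constant multiple of `Δ_g u`, and `h_g u` is a constant multiple of
`∂_ν u`. The assertion is therefore Green's formula `∫_M Δ_g u dv_g + ∫_{∂M} ∂_ν u dσ_g = 0`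
(`green`), which holds for every `u` that is `C²` up to the boundary; no property of the curvatures
themselves is needed.

A partition of unity reduces Green's formula to functions supported in one chart
(`green_of_tsupport_subset`). There it is the divergence theorem on the half-space
(`integral_sum_pd_eq_neg`) for the vector density `√(det g) ∇u` (`flux`), because
`√(det g) Δ_g u = -∂ᵢ fluxⁱ` and `√(det g_{ab}) ∂_ν u = -flux⁰`.

The Laplacian and the normal derivative at a point are computed in the preferred chart of that very
point, and the measures are suprema over all charts, so the substance lies in the invariance under
change of charts.

* With `J` the Jacobian of the transition map, `flux` transforms, up to the sign of `det J`, by the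
  adjugate of `J` (`flux_transition`). The Piola identity (`sum_fderiv_adjugate_jacobian`) then gives
  the invariance of the divergence at interior points (`laplacian_symm`). The boundary has volume
  zero, so interior points suffice.
* A transition map preserves the half-space and its boundary, hence at boundary points the row `J⁰`
  is `(J⁰₀, 0, …, 0)` with `J⁰₀ > 0`. This yields the invariance of the normal derivative
  (`normalDeriv_symm`) and of the induced metric (`gramTan_eq_transpose_mul`).
* By the change of variables formula the chart measures agree on overlaps, so their suprema
  restrict to each of them (`iSup_restrict_eq`, `volumeMeasure_restrict_source`,
  `boundaryMeasure_restrict_source`).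
-/

noncomputable section

namespace ConformalRobin

/-! ### Determinants and the Piola identity -/

section Determinants

variable {ι E : Type*} [Fintype ι] [DecidableEq ι] [NormedAddCommGroup E] [NormedSpace ℝ E]

theorem ContDiffWithinAt.matrix_det {A : E → Matrix ι ι ℝ} {s : Set E} {y : E} {k : ℕ∞ω}
    (hA : ∀ i j, ContDiffWithinAt ℝ k (fun z ↦ A z i j) s y) :
    ContDiffWithinAt ℝ k (fun z ↦ (A z).det) s y := by
  simp only [Matrix.det_apply']
  exact ContDiffWithinAt.sum fun σ _ ↦ contDiffWithinAt_const.mul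
    (contDiffWithinAt_prod fun i _ ↦ hA _ _)

theorem ContDiffWithinAt.matrix_adjugate {A : E → Matrix ι ι ℝ} {s : Set E} {y : E} {k : ℕ∞ω}
    (hA : ∀ i j, ContDiffWithinAt ℝ k (fun z ↦ A z i j) s y) (i j : ι) :
    ContDiffWithinAt ℝ k (fun z ↦ (A z).adjugate i j) s y := by
  simp only [Matrix.adjugate_apply]
  refine ContDiffWithinAt.matrix_det fun a b ↦ ?_
  by_cases h : a = j
  · subst h; simpa using contDiffWithinAt_const
  · simpa [Matrix.updateRow_ne h] using hA a b

theorem ContDiffWithinAt.matrix_inv {A : E → Matrix ι ι ℝ} {s : Set E} {y : E} {k : ℕ∞ω}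
    (hA : ∀ i j, ContDiffWithinAt ℝ k (fun z ↦ A z i j) s y) (hy : (A y).det ≠ 0) (i j : ι) :
    ContDiffWithinAt ℝ k (fun z ↦ (A z)⁻¹ i j) s y := by
  simp only [Matrix.inv_def, Ring.inverse_eq_inv', Matrix.smul_apply, smul_eq_mul]
  exact (ContDiffWithinAt.matrix_det hA).inv hy |>.mul (ContDiffWithinAt.matrix_adjugate hA i j)

theorem continuousOn_det {X : Type*} [TopologicalSpace X] {A : X → Matrix ι ι ℝ} {s : Set X}
    (hA : ∀ i j, ContinuousOn (fun z ↦ A z i j) s) : ContinuousOn (fun z ↦ (A z).det) s := by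
  simp only [Matrix.det_apply']
  exact continuousOn_finsetSum _ fun σ _ ↦ continuousOn_const.mul
    (continuousOn_finsetProd _ fun i _ ↦ hA _ _)

/-- Jacobi's formula for the derivative of the determinant. -/
theorem hasFDerivAt_det {A : E → Matrix ι ι ℝ} {A' : ι → ι → E →L[ℝ] ℝ} {y : E}
    (hA : ∀ i j, HasFDerivAt (fun z ↦ A z i j) (A' i j) y) :
    HasFDerivAt (fun z ↦ (A z).det) (∑ i, ∑ j, (A y).adjugate i j • A' j i) y := by
  have h : HasFDerivAt (fun z ↦ (A z).det) (∑ σ : Equiv.Perm ι, ((Equiv.Perm.sign σ : ℤ) : ℝ) •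
      ∑ i, (∏ j ∈ Finset.univ.erase i, A y (σ j) j) • A' (σ i) i) y := by
    simp only [Matrix.det_apply']
    exact HasFDerivAt.fun_sum fun σ _ ↦
      (HasFDerivAt.finsetProd fun i _ ↦ hA (σ i) i).const_mul _
  convert h using 1
  ext v
  have key : ∀ i, ∑ j, (A y).adjugate i j * A' j i v
      = ∑ σ : Equiv.Perm ι, ((Equiv.Perm.sign σ : ℤ) : ℝ) *
        ((∏ j ∈ Finset.univ.erase i, A y (σ j) j) * A' (σ i) i v) := by
    intro i
    have := congrFun (Matrix.cramer_eq_adjugate_mulVec (A y) fun j ↦ A' j i v) i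
    rw [Matrix.mulVec, dotProduct] at this
    rw [← this, Matrix.cramer_apply, Matrix.det_apply']
    refine Finset.sum_congr rfl fun σ _ ↦ ?_
    congr 1
    rw [← Finset.mul_prod_erase _ _ (Finset.mem_univ i), Matrix.updateCol_self, mul_comm]
    congr 1
    refine Finset.prod_congr rfl fun j hj ↦ ?_
    rw [Matrix.updateCol_ne (Finset.ne_of_mem_erase hj)]
  simp only [sum_apply, smul_apply, smul_eq_mul, key,
    Finset.mul_sum]
  rw [Finset.sum_comm]

end Determinants

section Piola

variable {n : ℕ}

/-- The matrix of an endomorphism of `ℝⁿ` in the standard basis. -/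
def coordMatrix (L : Coord n →L[ℝ] Coord n) : Matrix (Fin n) (Fin n) ℝ :=
  Matrix.of fun a i ↦ L (EuclideanSpace.single i 1) a

theorem coordMatrix_eq_toMatrix (L : Coord n →L[ℝ] Coord n) :
    coordMatrix L = LinearMap.toMatrix (EuclideanSpace.basisFun (Fin n) ℝ).toBasis
      (EuclideanSpace.basisFun (Fin n) ℝ).toBasis L := by
  ext a i
  simp [coordMatrix, LinearMap.toMatrix_apply]

theorem det_coordMatrix (L : Coord n →L[ℝ] Coord n) : (coordMatrix L).det = L.det := by
  rw [ContinuousLinearMap.det, coordMatrix_eq_toMatrix, LinearMap.det_toMatrix]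

theorem coordMatrix_comp (L L' : Coord n →L[ℝ] Coord n) :
    coordMatrix (L.comp L') = coordMatrix L * coordMatrix L' := by
  simp only [coordMatrix_eq_toMatrix]
  exact LinearMap.toMatrix_comp _ _ _ _ _

theorem apply_eq_sum_coordMatrix {F : Type*} [AddCommGroup F] [Module ℝ F] (φ : Coord n →ₗ[ℝ] F)
    (L : Coord n →L[ℝ] Coord n) (i : Fin n) :
    φ (L (EuclideanSpace.single i 1))
      = ∑ b, coordMatrix L b i • φ (EuclideanSpace.single b 1) := by
  conv_lhs => rw [← (EuclideanSpace.basisFun (Fin n) ℝ).sum_repr (L (EuclideanSpace.single i 1))]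
  simp [coordMatrix]

/-- The Jacobian matrix `(∂ᵢ ψᵃ)_{a, i}` of a map between open subsets of `ℝⁿ`. -/
def jacobian (ψ : Coord n → Coord n) (y : Coord n) : Matrix (Fin n) (Fin n) ℝ :=
  coordMatrix (fderiv ℝ ψ y)

/-- The Piola identity: the columns of the cofactor matrix of a Jacobian are divergence free. -/
theorem sum_fderiv_adjugate_jacobian {ψ : Coord n → Coord n} {y : Coord n}
    (hψ : ContDiffAt ℝ 2 ψ y) (hdet : (jacobian ψ y).det ≠ 0) (a : Fin n) :
    ∑ i, fderiv ℝ (fun z ↦ (jacobian ψ z).adjugate i a) y (EuclideanSpace.single i 1) = 0 := by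
  set e : Fin n → Coord n := fun i ↦ EuclideanSpace.single i 1 with he
  have hψ' : DifferentiableAt ℝ (fderiv ℝ ψ) y :=
    (hψ.fderiv_right (m := 1) (by norm_num)).differentiableAt (by norm_num)
  have hsymm : IsSymmSndFDerivAt ℝ ψ y := hψ.isSymmSndFDerivAt (by simp)
  have hJd : ∀ b i, ContDiffAt ℝ 1 (fun z ↦ jacobian ψ z b i) y := by
    intro b i
    have h1 : ContDiffAt ℝ 1 (fun z ↦ fderiv ℝ ψ z (e i)) y :=
      (hψ.fderiv_right (m := 1) (by norm_num)).clm_apply contDiffAt_const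
    exact (contDiffAt_euclidean.1 h1 b)
  have hJ : ∀ b i, fderiv ℝ (fun z ↦ jacobian ψ z b i) y
      = (EuclideanSpace.proj b).comp ((ContinuousLinearMap.apply ℝ _ (e i)).comp
          (fderiv ℝ (fderiv ℝ ψ) y)) := by
    intro b i
    refine HasFDerivAt.fderiv ?_
    exact ((EuclideanSpace.proj b).hasFDerivAt.comp y
      ((ContinuousLinearMap.apply ℝ _ (e i)).hasFDerivAt.comp y hψ'.hasFDerivAt))
  have hcomm : ∀ b i k, fderiv ℝ (fun z ↦ jacobian ψ z b i) y (e k)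
      = fderiv ℝ (fun z ↦ jacobian ψ z b k) y (e i) := by
    intro b i k
    rw [hJ, hJ]
    simp [hsymm.eq (e k) (e i)]
  have hadj : ∀ i b, DifferentiableAt ℝ (fun z ↦ (jacobian ψ z).adjugate i b) y := by
    intro i b
    have := ContDiffWithinAt.matrix_adjugate (s := univ) (fun b i ↦ (hJd b i).contDiffWithinAt) i b
    exact (contDiffWithinAt_univ.1 this).differentiableAt (by norm_num)
  have hJdiff : ∀ b i, DifferentiableAt ℝ (fun z ↦ jacobian ψ z b i) y :=
    fun b i ↦ (hJd b i).differentiableAt (by norm_num)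
  have hdetd := hasFDerivAt_det (A := jacobian ψ) fun b i ↦ (hJdiff b i).hasFDerivAt
  -- differentiate `adj J * J = det J • 1` entrywise
  have hprod : ∀ i k v, ∑ b, (fderiv ℝ (fun z ↦ (jacobian ψ z).adjugate i b) y v * jacobian ψ y b k
      + (jacobian ψ y).adjugate i b * fderiv ℝ (fun z ↦ jacobian ψ z b k) y v)
      = (if i = k then 1 else 0) * ∑ c, ∑ d, (jacobian ψ y).adjugate c d *
          fderiv ℝ (fun z ↦ jacobian ψ z d c) y v := by
    intro i k v
    have h1 : HasFDerivAt (fun z ↦ ∑ b, (jacobian ψ z).adjugate i b * jacobian ψ z b k) _ y :=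
      HasFDerivAt.fun_sum fun b _ ↦ (hadj i b).hasFDerivAt.mul (hJdiff b k).hasFDerivAt
    have h2 : (fun z ↦ ∑ b, (jacobian ψ z).adjugate i b * jacobian ψ z b k)
        = fun z ↦ (if i = k then (1 : ℝ) else 0) * (jacobian ψ z).det := by
      funext z
      have := congrFun (congrFun (Matrix.adjugate_mul (jacobian ψ z)) i) k
      rw [Matrix.mul_apply] at this
      rw [this, Matrix.smul_apply, Matrix.one_apply, smul_eq_mul, mul_comm]
    rw [h2] at h1
    have h3 := congrArg (fun L : Coord n →L[ℝ] ℝ ↦ L v) (h1.unique (hdetd.const_mul _))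
    simp only [sum_apply, add_apply,
      smul_apply, smul_eq_mul] at h3
    rw [← h3]
    exact Finset.sum_congr rfl fun b _ ↦ by ring
  -- hence the divergence row vector is annihilated by the invertible matrix `J`
  set w : Fin n → ℝ :=
    fun b ↦ ∑ i, fderiv ℝ (fun z ↦ (jacobian ψ z).adjugate i b) y (e i) with hw
  have hwJ : Matrix.vecMul w (jacobian ψ y) = 0 := by
    funext k
    have h1 : ∑ i, ∑ b, (fderiv ℝ (fun z ↦ (jacobian ψ z).adjugate i b) y (e i) * jacobian ψ y b k
        + (jacobian ψ y).adjugate i b * fderiv ℝ (fun z ↦ jacobian ψ z b k) y (e i))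
        = ∑ c, ∑ d, (jacobian ψ y).adjugate c d *
          fderiv ℝ (fun z ↦ jacobian ψ z d c) y (e k) := by
      simp only [hprod]
      rw [Finset.sum_eq_single k]
      · simp
      · intro i _ hik; simp [hik]
      · simp
    have h2 : ∑ c, ∑ d, (jacobian ψ y).adjugate c d *
          fderiv ℝ (fun z ↦ jacobian ψ z d c) y (e k)
        = ∑ c, ∑ d, (jacobian ψ y).adjugate c d *
          fderiv ℝ (fun z ↦ jacobian ψ z d k) y (e c) :=
      Finset.sum_congr rfl fun c _ ↦ Finset.sum_congr rfl fun d _ ↦ by rw [hcomm d c k]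
    simp only [Finset.sum_add_distrib] at h1
    rw [h2] at h1
    have h3 : ∑ i, ∑ b, fderiv ℝ (fun z ↦ (jacobian ψ z).adjugate i b) y (e i) * jacobian ψ y b k
      = 0 := by linarith
    rw [Finset.sum_comm] at h3
    simpa [Matrix.vecMul, dotProduct, hw, Finset.sum_mul] using h3
  exact congrFun (Matrix.eq_zero_of_vecMul_eq_zero hdet hwJ) a

/-- The divergence of the Piola transform of a vector field. -/
theorem sum_fderiv_adjugate_jacobian_mul {ψ : Coord n → Coord n} {y : Coord n}
    (hψ : ContDiffAt ℝ 2 ψ y) (hdet : (jacobian ψ y).det ≠ 0) {V : Fin n → Coord n → ℝ}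
    (hV : ∀ a, DifferentiableAt ℝ (V a) (ψ y)) :
    ∑ i, fderiv ℝ (fun z ↦ ∑ a, (jacobian ψ z).adjugate i a * V a (ψ z)) y
        (EuclideanSpace.single i 1)
      = (jacobian ψ y).det * ∑ a, fderiv ℝ (V a) (ψ y) (EuclideanSpace.single a 1) := by
  set e : Fin n → Coord n := fun i ↦ EuclideanSpace.single i 1 with he
  have hJd : ∀ b i, ContDiffAt ℝ 1 (fun z ↦ jacobian ψ z b i) y := by
    intro b i
    have h1 : ContDiffAt ℝ 1 (fun z ↦ fderiv ℝ ψ z (e i)) y :=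
      (hψ.fderiv_right (m := 1) (by norm_num)).clm_apply contDiffAt_const
    exact (contDiffAt_euclidean.1 h1 b)
  have hadj : ∀ i b, DifferentiableAt ℝ (fun z ↦ (jacobian ψ z).adjugate i b) y := by
    intro i b
    have := ContDiffWithinAt.matrix_adjugate (s := univ) (fun b i ↦ (hJd b i).contDiffWithinAt) i b
    exact (contDiffWithinAt_univ.1 this).differentiableAt (by norm_num)
  have hψd : DifferentiableAt ℝ ψ y := hψ.differentiableAt (by norm_num)
  have hchain : ∀ a i, fderiv ℝ (V a) (ψ y) (fderiv ℝ ψ y (e i))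
      = ∑ b, jacobian ψ y b i * fderiv ℝ (V a) (ψ y) (e b) := by
    intro a i
    exact apply_eq_sum_coordMatrix (fderiv ℝ (V a) (ψ y)).toLinearMap (fderiv ℝ ψ y) i
  have hterm : ∀ i, fderiv ℝ (fun z ↦ ∑ a, (jacobian ψ z).adjugate i a * V a (ψ z)) y (e i)
      = ∑ a, ((jacobian ψ y).adjugate i a * (∑ b, jacobian ψ y b i * fderiv ℝ (V a) (ψ y) (e b))
        + V a (ψ y) * fderiv ℝ (fun z ↦ (jacobian ψ z).adjugate i a) y (e i)) := by
    intro i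
    have h : HasFDerivAt (fun z ↦ ∑ a, (jacobian ψ z).adjugate i a * V a (ψ z)) _ y :=
      HasFDerivAt.fun_sum fun a _ ↦ (hadj i a).hasFDerivAt.mul
        ((hV a).hasFDerivAt.comp y hψd.hasFDerivAt)
    rw [h.fderiv]
    simp only [sum_apply, add_apply,
      smul_apply, smul_eq_mul, ContinuousLinearMap.comp_apply, hchain]
  have hone : ∀ a b, ∑ i, jacobian ψ y b i * (jacobian ψ y).adjugate i a
      = if b = a then (jacobian ψ y).det else 0 := by
    intro a b
    have := congrFun (congrFun (Matrix.mul_adjugate (jacobian ψ y)) b) a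
    rw [Matrix.mul_apply] at this
    rw [this, Matrix.smul_apply, Matrix.one_apply, smul_eq_mul, mul_ite, mul_one, mul_zero]
  calc _ = ∑ i, ∑ a, ((jacobian ψ y).adjugate i a *
        (∑ b, jacobian ψ y b i * fderiv ℝ (V a) (ψ y) (e b))
        + V a (ψ y) * fderiv ℝ (fun z ↦ (jacobian ψ z).adjugate i a) y (e i)) :=
        Finset.sum_congr rfl fun i _ ↦ hterm i
    _ = ∑ a, (∑ b, (∑ i, jacobian ψ y b i * (jacobian ψ y).adjugate i a) *
          fderiv ℝ (V a) (ψ y) (e b)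
        + V a (ψ y) * ∑ i, fderiv ℝ (fun z ↦ (jacobian ψ z).adjugate i a) y (e i)) := by
        rw [Finset.sum_comm]
        refine Finset.sum_congr rfl fun a _ ↦ ?_
        rw [Finset.sum_add_distrib, Finset.mul_sum]
        congr 1
        simp only [Finset.mul_sum, Finset.sum_mul]
        rw [Finset.sum_comm]
        exact Finset.sum_congr rfl fun b _ ↦ Finset.sum_congr rfl fun i _ ↦ by ring
    _ = _ := by
        simp only [hone, sum_fderiv_adjugate_jacobian hψ hdet, he, ite_mul, zero_mul, mul_zero,
          add_zero, Finset.sum_ite_eq', Finset.mem_univ, if_true, Finset.mul_sum]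

end Piola

/-! ### The divergence theorem on the half-space, and gluing of measures -/

section HalfSpace

variable {n : ℕ} [NeZero n]

theorem continuous_bdryIncl : Continuous (bdryIncl (n := n)) := by
  refine (PiLp.continuous_toLp 2 _).comp (continuous_pi fun i ↦ ?_)
  by_cases h : i = 0
  · simpa [h] using continuous_const
  · simpa [h] using continuous_apply _

theorem bdryIncl_apply_zero (z : {i : Fin n // i ≠ 0} → ℝ) : bdryIncl z 0 = 0 := by
  simp [bdryIncl]

theorem bdryIncl_apply_coe (z : {i : Fin n // i ≠ 0} → ℝ) (a : {i : Fin n // i ≠ 0}) :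
    bdryIncl z a = z a := by
  simp [bdryIncl, a.2]

theorem mem_range_model {y : Coord n} : y ∈ range (𝓡∂ n) ↔ 0 ≤ y 0 := by
  rw [range_modelWithCornersEuclideanHalfSpace]; rfl

theorem bdryIncl_mem_range (z : {i : Fin n // i ≠ 0} → ℝ) : bdryIncl z ∈ range (𝓡∂ n) := by
  rw [mem_range_model, bdryIncl_apply_zero]

theorem uniqueDiffOn_range_model : UniqueDiffOn ℝ (range (𝓡∂ n)) := (𝓡∂ n).uniqueDiffOn

theorem continuousOn_pd {f : Coord n → ℝ} (hf : ContDiffOn ℝ 1 f (range (𝓡∂ n))) (i : Fin n) :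
    ContinuousOn (pd i f) (range (𝓡∂ n)) :=
  (hf.continuousOn_fderivWithin uniqueDiffOn_range_model (by norm_num)).clm_apply
    continuousOn_const

theorem pd_eq_zero_of_notMem {f : Coord n → ℝ} {K : Set (Coord n)} (hK : IsClosed K)
    (h0 : ∀ y ∉ K, f y = 0) {y : Coord n} (hy : y ∉ K) (i : Fin n) : pd i f y = 0 := by
  have h : f =ᶠ[nhds y] fun _ ↦ 0 := by
    filter_upwards [hK.isOpen_compl.mem_nhds hy] with z hz using h0 z hz
  rw [pd, (h.filter_mono nhdsWithin_le_nhds).fderivWithin_eq h.self_of_nhds]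
  simp

theorem integrableOn_sum_pd {F : Fin n → Coord n → ℝ} {K : Set (Coord n)} (hK : IsCompact K)
    (hF : ∀ i, ContDiffOn ℝ 1 (F i) (range (𝓡∂ n))) (h0 : ∀ i, ∀ y ∉ K, F i y = 0) :
    IntegrableOn (fun y ↦ ∑ i, pd i (F i) y) (range (𝓡∂ n)) := by
  have hcont : ContinuousOn (fun y ↦ ∑ i, pd i (F i) y) (range (𝓡∂ n)) :=
    continuousOn_finsetSum _ fun i _ ↦ continuousOn_pd (hF i) i
  have hcl : IsClosed (range (𝓡∂ n)) := (𝓡∂ n).isClosed_range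
  have h1 : IntegrableOn (fun y ↦ ∑ i, pd i (F i) y) (range (𝓡∂ n) ∩ K) :=
    (hcont.mono inter_subset_left).integrableOn_compact (hK.inter_left hcl)
  refine h1.of_forall_sdiff_eq_zero hcl.measurableSet fun y hy ↦ ?_
  have hyK : y ∉ K := fun h ↦ hy.2 ⟨hy.1, h⟩
  exact Finset.sum_eq_zero fun i _ ↦ pd_eq_zero_of_notMem hK.isClosed (h0 i) hyK i

/-- The divergence theorem on the half-space, for compactly supported vector fields which are
continuously differentiable up to the boundary. -/
theorem integral_sum_pd_eq_neg {F : Fin n → Coord n → ℝ} {K : Set (Coord n)} (hK : IsCompact K)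
    (hF : ∀ i, ContDiffOn ℝ 1 (F i) (range (𝓡∂ n))) (h0 : ∀ i, ∀ y ∉ K, F i y = 0) :
    ∫ y in range (𝓡∂ n), ∑ i, pd i (F i) y = -∫ z, F 0 (bdryIncl z) := by
  obtain ⟨m, rfl⟩ : ∃ m, n = m + 1 := ⟨n - 1, (Nat.succ_pred (NeZero.ne n)).symm⟩
  obtain ⟨R, hR0, hR⟩ : ∃ R : ℝ, 0 < R ∧ ∀ y ∈ K, ‖y‖ < R := by
    obtain ⟨R, hR⟩ := hK.isBounded.exists_norm_le
    exact ⟨max R 0 + 1, by positivity, fun y hy ↦ by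
      have := hR y hy
      have := le_max_left R 0
      linarith⟩
  have hRi : ∀ y ∈ K, ∀ i, |y i| < R := fun y hy i ↦ by
    have := PiLp.norm_apply_le y i
    rw [Real.norm_eq_abs] at this
    exact this.trans_lt (hR y hy)
  have hcl : IsClosed (range (𝓡∂ (m + 1))) := (𝓡∂ (m + 1)).isClosed_range
  -- the box `[0, R] × [-R, R]ᵐ` contains the part of `K` in the half-space
  set a : Fin (m + 1) → ℝ := Fin.cons 0 fun _ ↦ -R with ha
  set b : Fin (m + 1) → ℝ := fun _ ↦ R with hb
  have haS : ∀ i : Fin m, a i.succ = -R := fun i ↦ rfl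
  have hle : a ≤ b := by
    intro i
    refine Fin.cases ?_ (fun j ↦ ?_) i
    · exact hR0.le
    · rw [haS]; simp only [hb]; linarith
  set L := (EuclideanSpace.equiv (Fin (m + 1)) ℝ).symm with hL
  have hLa : ∀ x i, L x i = x i := fun x i ↦ rfl
  have hLmem : ∀ x ∈ Icc a b, L x ∈ range (𝓡∂ (m + 1)) := fun x hx ↦ by
    rw [mem_range_model]; exact hx.1 0
  have hvol : MeasurePreserving (WithLp.toLp 2 : (Fin (m + 1) → ℝ) → Coord (m + 1)) :=
    PiLp.volume_preserving_toLp (Fin (m + 1))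
  have hemb : MeasurableEmbedding (WithLp.toLp 2 : (Fin (m + 1) → ℝ) → Coord (m + 1)) :=
    (MeasurableEquiv.toLp 2 _).measurableEmbedding
  set D : Coord (m + 1) → ℝ := fun y ↦ ∑ i, pd i (F i) y with hD
  have hint := integrableOn_sum_pd hK hF h0
  have hbox : ∀ y ∈ range (𝓡∂ (m + 1)), y ∈ K → y ∈ L '' Icc a b := by
    intro y hy hyK
    refine ⟨fun i ↦ y i, ⟨fun i ↦ ?_, fun i ↦ (abs_lt.1 (hRi y hyK i)).2.le⟩, rfl⟩
    refine Fin.cases ?_ (fun j ↦ ?_) i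
    · exact mem_range_model.1 hy
    · exact (abs_lt.1 (hRi y hyK _)).1.le
  have hsub : L '' Icc a b ⊆ range (𝓡∂ (m + 1)) := by
    rintro _ ⟨x, hx, rfl⟩; exact hLmem x hx
  have hpre : (WithLp.toLp 2) ⁻¹' (L '' Icc a b) = Icc a b :=
    preimage_image_eq _ (WithLp.toLp_injective 2)
  have h1 : ∫ y in range (𝓡∂ (m + 1)), D y = ∫ x in Icc a b, D (L x) := by
    rw [setIntegral_eq_of_subset_of_forall_sdiff_eq_zero (s := L '' Icc a b) hcl.measurableSet hsub]
    · rw [← hvol.setIntegral_preimage_emb hemb, hpre]; rfl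
    · intro y hy
      exact Finset.sum_eq_zero fun i _ ↦ pd_eq_zero_of_notMem hK.isClosed (h0 i)
        (fun h ↦ hy.2 (hbox y hy.1 h)) i
  have hint' : IntegrableOn (fun x ↦ D (L x)) (Icc a b) := by
    have := (hvol.integrableOn_comp_preimage hemb).2 (hint.mono_set hsub)
    rwa [hpre] at this
  have h2 := integral_divergence_of_hasFDerivAt_off_countable' a b hle (fun i x ↦ F i (L x))
    (fun i x ↦ (fderivWithin ℝ (F i) (range (𝓡∂ (m + 1))) (L x)).comp L.toContinuousLinearMap) ∅
    countable_empty
    (fun i ↦ (hF i).continuousOn.comp L.continuous.continuousOn hLmem)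
    (by
      intro x hx i
      have hx0 : 0 < L x 0 := (hx.1 0 (mem_univ _)).1
      have hn : range (𝓡∂ (m + 1)) ∈ nhds (L x) := by
        rw [← mem_interior_iff_mem_nhds, interior_range_modelWithCornersEuclideanHalfSpace]
        exact hx0
      have hd : DifferentiableWithinAt ℝ (F i) (range (𝓡∂ (m + 1))) (L x) :=
        (hF i).differentiableOn (by norm_num) _ (mem_of_mem_nhds hn)
      exact (hd.hasFDerivWithinAt.hasFDerivAt hn).comp x L.hasFDerivAt)
    hint'
  have h3 : (∫ x in Icc a b, D (L x)) = _ := h2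
  rw [h1, h3, Fin.sum_univ_succ]
  have hz1 : ∀ i x, R ≤ |(L x) i| → ∀ k, F k (L x) = 0 := fun i x hx k ↦
    h0 k _ fun h ↦ absurd (hRi _ h i) (not_lt.2 hx)
  have hRabs : R ≤ |R| := le_abs_self R
  -- the field vanishes on all faces of the box except `y₀ = 0`
  have hfront : ∀ i x, F i (L (i.insertNth (b i) x)) = 0 := fun i x ↦ by
    refine hz1 i _ ?_ i
    rw [hLa, Fin.insertNth_apply_same]; exact hRabs
  have hback : ∀ (i : Fin m) x, F i.succ (L (i.succ.insertNth (a i.succ) x)) = 0 := fun i x ↦ by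
    refine hz1 i.succ _ ?_ _
    rw [hLa, Fin.insertNth_apply_same, haS, abs_neg]; exact hRabs
  simp only [hfront, hback, integral_zero, sub_self, Finset.sum_const_zero, zero_sub, add_zero]
  congr 1
  -- the remaining face lies in the hyperplane `y₀ = 0`
  set e : Fin m ≃ {i : Fin (m + 1) // i ≠ 0} := finSuccAboveEquiv 0 with he
  have hmp := volume_measurePreserving_piCongrLeft (fun _ : {i : Fin (m + 1) // i ≠ 0} ↦ ℝ) e
  rw [← hmp.integral_comp' (g := fun z ↦ F 0 (bdryIncl z))]
  have hface : ∀ x : Fin m → ℝ,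
      L (Fin.insertNth 0 (a 0) x)
        = bdryIncl (MeasurableEquiv.piCongrLeft (fun _ : {i : Fin (m + 1) // i ≠ 0} ↦ ℝ) e x) := by
    intro x
    ext i
    refine Fin.cases ?_ (fun j ↦ ?_) i
    · rw [bdryIncl_apply_zero]; rfl
    · have h1 : (j.succ : Fin (m + 1)) = ((e j : {i : Fin (m + 1) // i ≠ 0}) : Fin (m + 1)) := by
        exact (congrFun Fin.succAbove_zero j).symm
      rw [h1, bdryIncl_apply_coe, MeasurableEquiv.coe_piCongrLeft, Equiv.piCongrLeft_apply_apply,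
        ← h1]
      rfl
  simp only [hface]
  refine setIntegral_eq_integral_of_forall_compl_eq_zero fun x hx ↦ ?_
  rw [← hface]
  -- a boundary point off the face has a coordinate of size at least `R`
  have : ∃ j : Fin m, R ≤ |x j| := by
    by_contra hcon
    push Not at hcon
    refine hx ⟨fun j ↦ ?_, fun j ↦ ?_⟩
    · have := (abs_lt.1 (hcon j)).1.le
      simpa [haS] using this
    · exact (abs_lt.1 (hcon j)).2.le
  obtain ⟨j, hj⟩ := this
  refine hz1 j.succ _ ?_ _
  simpa [hLa] using hj

end HalfSpace

section Gluing

/-- Measures `m i` carried by sets `S i` and agreeing on the overlaps `S i ∩ S j` are recovered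
from their supremum: adding to `m i` the measure that is infinite on every nonempty set outside
`S i` gives an upper bound of the whole family. -/
theorem iSup_restrict_eq {ι X : Type*} [MeasurableSpace X] {m : ι → Measure X} {S : ι → Set X}
    (hS : ∀ i, MeasurableSet (S i)) (hm : ∀ i, m i (S i)ᶜ = 0)
    (hagree : ∀ i j A, MeasurableSet A → A ⊆ S i ∩ S j → m i A = m j A) (i : ι) :
    (⨆ j, m j).restrict (S i) = m i := by
  have hbound : ⨆ j, m j ≤ m i + ((⊤ : ENNReal) • Measure.count).restrict (S i)ᶜ := by
    refine iSup_le fun j ↦ Measure.le_iff.2 fun A hA ↦ ?_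
    rw [Measure.add_apply, Measure.restrict_apply hA, Measure.smul_apply, smul_eq_mul,
      ← sdiff_eq, ← measure_inter_add_sdiff A (hS i)]
    refine add_le_add ?_ ?_
    · have h1 : m j (A ∩ S i) = m j (A ∩ S i ∩ S j) := by
        refine (measure_inter_conull' ?_).symm
        exact measure_mono_null (fun x hx ↦ hx.2) (hm j)
      rw [h1, ← hagree i j _ ((hA.inter (hS i)).inter (hS j)) fun x hx ↦ ⟨hx.1.2, hx.2⟩]
      exact measure_mono fun x hx ↦ hx.1.1
    · rcases (A \ S i).eq_empty_or_nonempty with h | h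
      · simp [h]
      · rw [ENNReal.top_mul]
        · exact le_top
        · exact (Measure.count_ne_zero_iff (s := A \ S i)).2 h
  refine Measure.ext fun A hA ↦ ?_
  rw [Measure.restrict_apply hA]
  refine le_antisymm ?_ ?_
  · refine (hbound (A ∩ S i)).trans ?_
    rw [Measure.add_apply, Measure.restrict_apply (hA.inter (hS i))]
    have : A ∩ S i ∩ (S i)ᶜ = ∅ := by ext x; simp
    rw [this, measure_empty, add_zero]
    exact measure_mono inter_subset_left
  · have : m i A = m i (A ∩ S i) := (measure_inter_conull' (measure_mono_null
      (fun x hx ↦ hx.2) (hm i))).symm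
    rw [this]
    exact Measure.le_iff'.1 (le_iSup m i) _

end Gluing

/-! ### Transition maps -/

section Charts

variable {n : ℕ} [NeZero n] {M : Type*} [TopologicalSpace M]
  [ChartedSpace (EuclideanHalfSpace n) M]

/-- The coordinate domain of the chart around `x` on which the transition map to the chart around
`x'` is defined. -/
def overlap (x x' : M) : Set (Coord n) :=
  ((extChartAt (𝓡∂ n) x).symm ≫ extChartAt (𝓡∂ n) x').source

/-- The transition map from the chart around `x` to the chart around `x'`. -/
def transition (x x' : M) : Coord n → Coord n :=
  extChartAt (𝓡∂ n) x' ∘ (extChartAt (𝓡∂ n) x).symm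

/-- The derivative of the transition map, one-sided at boundary points. -/
def transitionDeriv (x x' : M) (y : Coord n) : Coord n →L[ℝ] Coord n :=
  fderivWithin ℝ (transition x x') (range (𝓡∂ n)) y

/-- The Jacobian matrix of the transition map, one-sided at boundary points. -/
def transitionMatrix (x x' : M) (y : Coord n) : Matrix (Fin n) (Fin n) ℝ :=
  coordMatrix (transitionDeriv x x' y)

theorem mem_overlap {x x' : M} {y : Coord n} : y ∈ overlap x x' ↔
    y ∈ (extChartAt (𝓡∂ n) x).target ∧
      (extChartAt (𝓡∂ n) x).symm y ∈ (extChartAt (𝓡∂ n) x').source := by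
  simp [overlap]

theorem mem_target_of_mem_overlap {x x' : M} {y : Coord n} (hy : y ∈ overlap x x') :
    y ∈ (extChartAt (𝓡∂ n) x).target := (mem_overlap.1 hy).1

theorem target_subset_range (x : M) : (extChartAt (𝓡∂ n) x).target ⊆ range (𝓡∂ n) :=
  extChartAt_target_subset_range x

theorem mem_range_of_mem_overlap {x x' : M} {y : Coord n} (hy : y ∈ overlap x x') :
    y ∈ range (𝓡∂ n) := target_subset_range x (mem_target_of_mem_overlap hy)

theorem symm_transition {x x' : M} {y : Coord n} (hy : y ∈ overlap x x') :
    (extChartAt (𝓡∂ n) x').symm (transition x x' y) = (extChartAt (𝓡∂ n) x).symm y :=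
  (extChartAt (𝓡∂ n) x').left_inv (mem_overlap.1 hy).2

theorem transition_mem_overlap {x x' : M} {y : Coord n} (hy : y ∈ overlap x x') :
    transition x x' y ∈ overlap x' x := by
  rw [mem_overlap, symm_transition hy]
  exact ⟨(extChartAt (𝓡∂ n) x').map_source (mem_overlap.1 hy).2,
    (extChartAt (𝓡∂ n) x).map_target (mem_overlap.1 hy).1⟩

theorem transition_transition {x x' : M} {y : Coord n} (hy : y ∈ overlap x x') :
    transition x' x (transition x x' y) = y := by
  change extChartAt (𝓡∂ n) x ((extChartAt (𝓡∂ n) x').symm (transition x x' y)) = y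
  rw [symm_transition hy, (extChartAt (𝓡∂ n) x).right_inv (mem_overlap.1 hy).1]

theorem mapsTo_transition (x x' : M) : MapsTo (transition x x') (overlap x x') (range (𝓡∂ n)) :=
  fun _ hy ↦ mem_range_of_mem_overlap (transition_mem_overlap hy)

theorem injOn_transition (x x' : M) : InjOn (transition (n := n) x x') (overlap x x') := by
  intro y hy z hz h
  rw [← transition_transition hy, h, transition_transition hz]

theorem target_mem_nhdsWithin {x : M} {y : Coord n} (hy : y ∈ (extChartAt (𝓡∂ n) x).target) :
    (extChartAt (𝓡∂ n) x).target ∈ nhdsWithin y (range (𝓡∂ n)) :=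
  extChartAt_target_mem_nhdsWithin_of_mem hy

theorem overlap_mem_nhdsWithin {x x' : M} {y : Coord n} (hy : y ∈ overlap x x') :
    overlap x x' ∈ nhdsWithin y (range (𝓡∂ n)) := by
  have hyt := mem_target_of_mem_overlap hy
  have h1 := (continuousOn_extChartAt_symm x y hyt).preimage_mem_nhdsWithin
    ((isOpen_extChartAt_source (I := 𝓡∂ n) x').mem_nhds (mem_overlap.1 hy).2)
  rw [nhdsWithin_extChartAt_target_eq_of_mem hyt] at h1
  filter_upwards [h1, target_mem_nhdsWithin hyt] with z hz1 hz2 using mem_overlap.2 ⟨hz2, hz1⟩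

theorem measurableSet_target (x : M) : MeasurableSet (extChartAt (𝓡∂ n) x).target := by
  rw [extChartAt_target]
  exact ((chartAt (EuclideanHalfSpace n) x).open_target.preimage
    (𝓡∂ n).continuous_symm).measurableSet.inter
    (𝓡∂ n).isClosed_range.measurableSet

variable [IsManifold (𝓡∂ n) ∞ M]

theorem contDiffWithinAt_transition {x x' : M} {y : Coord n} (hy : y ∈ overlap x x') :
    ContDiffWithinAt ℝ ∞ (transition x x') (range (𝓡∂ n)) y :=
  contDiffWithinAt_ext_coord_change x' x hy

theorem hasFDerivWithinAt_transition {x x' : M} {y : Coord n} (hy : y ∈ overlap x x') :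
    HasFDerivWithinAt (transition x x') (transitionDeriv x x' y) (range (𝓡∂ n)) y :=
  ((contDiffWithinAt_transition hy).differentiableWithinAt (by simp)).hasFDerivWithinAt

theorem hasFDerivWithinAt_comp_transition {F : Type*} [NormedAddCommGroup F] [NormedSpace ℝ F]
    {x x' : M} {y : Coord n} (hy : y ∈ overlap x x') {f : Coord n → F}
    (hf : DifferentiableWithinAt ℝ f (range (𝓡∂ n)) (transition x x' y)) :
    HasFDerivWithinAt (f ∘ transition x x')
      ((fderivWithin ℝ f (range (𝓡∂ n)) (transition x x' y)).comp (transitionDeriv x x' y))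
      (range (𝓡∂ n)) y := by
  have h : HasFDerivWithinAt (f ∘ transition x x')
      ((fderivWithin ℝ f (range (𝓡∂ n)) (transition x x' y)).comp (transitionDeriv x x' y))
      (overlap x x') y :=
    hf.hasFDerivWithinAt.comp y ((hasFDerivWithinAt_transition hy).mono
      fun z hz ↦ mem_range_of_mem_overlap hz) (mapsTo_transition x x')
  exact h.mono_of_mem_nhdsWithin (overlap_mem_nhdsWithin hy)

theorem transitionDeriv_comp {x x' : M} {y : Coord n} (hy : y ∈ overlap x x') :
    (transitionDeriv x' x (transition x x' y)).comp (transitionDeriv x x' y)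
      = ContinuousLinearMap.id ℝ (Coord n) := by
  have h1 := hasFDerivWithinAt_comp_transition hy (f := transition x' x)
    (hasFDerivWithinAt_transition (transition_mem_overlap hy)).differentiableWithinAt
  have h2 : HasFDerivWithinAt (transition x' x ∘ transition x x')
      (ContinuousLinearMap.id ℝ (Coord n)) (range (𝓡∂ n)) y := by
    refine (hasFDerivWithinAt_id y _).congr_of_eventuallyEq ?_ (transition_transition hy)
    filter_upwards [overlap_mem_nhdsWithin hy] with z hz using transition_transition hz
  exact (uniqueDiffOn_range_model y (mem_range_of_mem_overlap hy)).eq h1 h2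

theorem transitionMatrix_mul {x x' : M} {y : Coord n} (hy : y ∈ overlap x x') :
    transitionMatrix x' x (transition x x' y) * transitionMatrix x x' y = 1 := by
  rw [transitionMatrix, transitionMatrix, ← coordMatrix_comp, transitionDeriv_comp hy]
  ext a i
  simp [coordMatrix, Matrix.one_apply]

theorem det_transitionMatrix_ne_zero {x x' : M} {y : Coord n} (hy : y ∈ overlap x x') :
    (transitionMatrix x x' y).det ≠ 0 := by
  have := congrArg Matrix.det (transitionMatrix_mul hy)
  rw [Matrix.det_mul, Matrix.det_one] at this
  exact right_ne_zero_of_mul_eq_one this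

/-! ### The boundary in charts -/

/-- Whether a point lies on `∂M` is visible in any chart, by the invariance of the boundary. -/
theorem mem_boundary_iff {x q : M} (hq : q ∈ (extChartAt (𝓡∂ n) x).source) :
    q ∈ (𝓡∂ n).boundary M ↔ extChartAt (𝓡∂ n) x q 0 = 0 := by
  have hmem := (extChartAt (𝓡∂ n) x).map_source hq
  have h1 := (𝓡∂ n).isInteriorPoint_iff_of_mem_atlas (n := ∞) (by simp)
    (chart_mem_atlas (EuclideanHalfSpace n) x) (by rwa [extChartAt_source] at hq)
  have h2 : (extChartAt (𝓡∂ n) x q ∈ interior (extChartAt (𝓡∂ n) x).target)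
      ↔ extChartAt (𝓡∂ n) x q ∈ interior (range (𝓡∂ n)) := by
    constructor
    · exact fun h ↦ interior_mono (target_subset_range x) h
    · intro h
      rw [mem_interior_iff_mem_nhds] at h ⊢
      have := target_mem_nhdsWithin hmem
      rwa [nhdsWithin_eq_nhds.2 h] at this
  change (𝓡∂ n).IsBoundaryPoint q ↔ _
  rw [ModelWithCorners.isBoundaryPoint_iff_not_isInteriorPoint, h1]
  change ¬ (extChartAt (𝓡∂ n) x q ∈ interior (extChartAt (𝓡∂ n) x).target) ↔ _
  rw [h2, interior_range_modelWithCornersEuclideanHalfSpace]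
  have h3 := mem_range_model.1 (target_subset_range x hmem)
  change ¬ (0 < extChartAt (𝓡∂ n) x q 0) ↔ _
  rw [not_lt]
  exact ⟨fun h ↦ le_antisymm h h3, fun h ↦ h.le⟩

theorem symm_mem_boundary_iff {x : M} {y : Coord n} (hy : y ∈ (extChartAt (𝓡∂ n) x).target) :
    (extChartAt (𝓡∂ n) x).symm y ∈ (𝓡∂ n).boundary M ↔ y 0 = 0 := by
  rw [mem_boundary_iff ((extChartAt (𝓡∂ n) x).map_target hy),
    (extChartAt (𝓡∂ n) x).right_inv hy]

theorem transition_apply_zero_iff {x x' : M} {y : Coord n} (hy : y ∈ overlap x x') :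
    transition x x' y 0 = 0 ↔ y 0 = 0 := by
  rw [← symm_mem_boundary_iff (mem_target_of_mem_overlap hy), ← symm_transition hy,
    symm_mem_boundary_iff (mem_target_of_mem_overlap (transition_mem_overlap hy))]

/-- At a boundary point the function `ψ⁰` attains its minimum over the half-space, so its
derivative is nonnegative on vectors pointing into the half-space. -/
theorem transitionDeriv_apply_zero_nonneg {x x' : M} {y : Coord n} (hy : y ∈ overlap x x')
    (hy0 : y 0 = 0) {v : Coord n} (hv : 0 ≤ v 0) : 0 ≤ transitionDeriv x x' y v 0 := by
  have h1 : HasFDerivWithinAt (fun z ↦ transition x x' z 0)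
      ((EuclideanSpace.proj (0 : Fin n)).comp (transitionDeriv x x' y)) (range (𝓡∂ n)) y :=
    (EuclideanSpace.proj (0 : Fin n) : Coord n →L[ℝ] ℝ).hasFDerivAt.comp_hasFDerivWithinAt
      y (hasFDerivWithinAt_transition hy)
  have h2 : IsLocalMinOn (fun z ↦ transition x x' z 0) (range (𝓡∂ n)) y := by
    filter_upwards [overlap_mem_nhdsWithin hy] with z hz
    rw [(transition_apply_zero_iff hy).2 hy0]
    exact mem_range_model.1 (mapsTo_transition x x' hz)
  have h3 : v ∈ posTangentConeAt (range (𝓡∂ n)) y := by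
    refine mem_posTangentConeAt_of_segment_subset ?_
    refine (𝓡∂ n).convex_range.segment_subset (mem_range_of_mem_overlap hy) ?_
    rw [mem_range_model]
    simpa [hy0] using hv
  exact h2.hasFDerivWithinAt_nonneg h1 h3

/-- At a boundary point the transition map sends tangential vectors to tangential vectors. -/
theorem transitionMatrix_zero_of_ne {x x' : M} {y : Coord n} (hy : y ∈ overlap x x')
    (hy0 : y 0 = 0) {a : Fin n} (ha : a ≠ 0) : transitionMatrix x x' y 0 a = 0 := by
  have h1 := transitionDeriv_apply_zero_nonneg hy hy0 (v := EuclideanSpace.single a 1)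
    (by simp [ha.symm])
  have h2 := transitionDeriv_apply_zero_nonneg hy hy0 (v := -EuclideanSpace.single a 1)
    (by simp [ha.symm])
  rw [map_neg] at h2
  have h3 : 0 ≤ -(transitionDeriv x x' y (EuclideanSpace.single a 1) 0) := h2
  exact le_antisymm (neg_nonneg.1 h3) h1

/-- At a boundary point the transition map keeps the inward direction. -/
theorem transitionMatrix_zero_zero_pos {x x' : M} {y : Coord n} (hy : y ∈ overlap x x')
    (hy0 : y 0 = 0) : 0 < transitionMatrix x x' y 0 0 := by
  refine lt_of_le_of_ne (transitionDeriv_apply_zero_nonneg hy hy0 (by simp)) fun h ↦ ?_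
  refine det_transitionMatrix_ne_zero hy (Matrix.det_eq_zero_of_row_eq_zero 0 fun a ↦ ?_)
  by_cases ha : a = 0
  · rw [ha]; exact h.symm
  · exact transitionMatrix_zero_of_ne hy hy0 ha

/-! ### The metric in charts -/

/-- The differential `d(φ⁻¹)_y` of the inverse of the chart `φ` around `x`. -/
def frame (x : M) (y : Coord n) : Coord n →L[ℝ] Coord n :=
  mfderivWithin 𝓘(ℝ, Coord n) (𝓡∂ n) (extChartAt (𝓡∂ n) x).symm (range (𝓡∂ n)) y

/-- The metric at `p`, as a bilinear form on the model space. -/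
def metricForm (g : Metric n M) (p : M) : Coord n →L[ℝ] Coord n →L[ℝ] ℝ := g.inner p

theorem gram_apply (g : Metric n M) (x : M) (y : Coord n) (i j : Fin n) :
    gram g x y i j = metricForm g ((extChartAt (𝓡∂ n) x).symm y)
      (frame x y (EuclideanSpace.single i 1)) (frame x y (EuclideanSpace.single j 1)) := rfl

/-- The chain rule for `φ⁻¹ = φ'⁻¹ ∘ ψ`, where `ψ` is the transition map. -/
theorem frame_eq_comp {x x' : M} {y : Coord n} (hy : y ∈ overlap x x') :
    frame x y = (frame x' (transition x x' y)).comp (transitionDeriv x x' y) := by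
  have hI : IsManifold (𝓡∂ n) 1 M := IsManifold.of_le (n := ∞) (by simp)
  have hty := mem_target_of_mem_overlap (transition_mem_overlap hy)
  have hmd : ∀ (x : M) {z : Coord n}, z ∈ (extChartAt (𝓡∂ n) x).target →
      MDifferentiableWithinAt 𝓘(ℝ, Coord n) (𝓡∂ n) (extChartAt (𝓡∂ n) x).symm
        (range (𝓡∂ n)) z := fun x z hz ↦ mdifferentiableWithinAt_extChartAt_symm hz
  have h1 : HasMFDerivWithinAt 𝓘(ℝ, Coord n) (𝓡∂ n)
      ((extChartAt (𝓡∂ n) x').symm ∘ transition x x') (overlap x x') y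
      ((frame x' (transition x x' y)).comp (transitionDeriv x x' y)) := by
    refine HasMFDerivWithinAt.comp y (hmd x' hty).hasMFDerivWithinAt
      ((hasFDerivWithinAt_transition hy).mono fun z hz ↦ ?_).hasMFDerivWithinAt
      (mapsTo_transition x x')
    exact mem_range_of_mem_overlap hz
  have h2 : HasMFDerivWithinAt 𝓘(ℝ, Coord n) (𝓡∂ n)
      (extChartAt (𝓡∂ n) x).symm (overlap x x') y
      ((frame x' (transition x x' y)).comp (transitionDeriv x x' y)) :=
    h1.congr_mono (fun z hz ↦ (symm_transition hz).symm) (symm_transition hy).symm subset_rfl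
  have h3 : HasMFDerivWithinAt 𝓘(ℝ, Coord n) (𝓡∂ n)
      (extChartAt (𝓡∂ n) x).symm (range (𝓡∂ n)) y
      ((frame x' (transition x x' y)).comp (transitionDeriv x x' y)) :=
    h2.mono_of_mem_nhdsWithin (overlap_mem_nhdsWithin hy)
  exact h3.mfderivWithin
    (uniqueDiffOn_range_model y (mem_range_of_mem_overlap hy)).uniqueMDiffWithinAt

/-- The transformation rule of the metric coefficients. -/
theorem gram_eq_transpose_mul (g : Metric n M) {x x' : M} {y : Coord n} (hy : y ∈ overlap x x') :
    gram g x y = (transitionMatrix x x' y).transpose * gram g x' (transition x x' y) *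
      transitionMatrix x x' y := by
  ext i j
  rw [gram_apply, frame_eq_comp hy, Matrix.mul_apply]
  simp only [Matrix.mul_apply, Matrix.transpose_apply, gram_apply, symm_transition hy]
  set B := metricForm g ((extChartAt (𝓡∂ n) x).symm y)
  set f := frame x' (transition x x' y)
  have h2 : ∀ v : Coord n, B v (f (transitionDeriv x x' y (EuclideanSpace.single j 1)))
      = ∑ b, transitionMatrix x x' y b j * B v (f (EuclideanSpace.single b 1)) := fun v ↦
    apply_eq_sum_coordMatrix ((B v).comp f).toLinearMap (transitionDeriv x x' y) j
  have h1 : ∀ v : Coord n, B (f (transitionDeriv x x' y (EuclideanSpace.single i 1))) v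
      = ∑ a, transitionMatrix x x' y a i * B (f (EuclideanSpace.single a 1)) v := fun v ↦
    apply_eq_sum_coordMatrix ((B.flip v).comp f).toLinearMap (transitionDeriv x x' y) i
  rw [ContinuousLinearMap.comp_apply, ContinuousLinearMap.comp_apply, h2]
  refine Finset.sum_congr rfl fun b _ ↦ ?_
  rw [h1, mul_comm]

theorem injective_frame {x : M} {y : Coord n} (hy : y ∈ (extChartAt (𝓡∂ n) x).target) :
    Function.Injective (frame x y) := by
  have hI : IsManifold (𝓡∂ n) 1 M := IsManifold.of_le (n := ∞) (by simp)
  obtain ⟨e, he⟩ := isInvertible_mfderivWithin_extChartAt_symm (I := 𝓡∂ n) hy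
  have : ∀ v, frame x y v = e v := fun v ↦ congrArg (fun L ↦ L v) he.symm
  intro v w h
  rw [this, this] at h
  exact e.injective h

theorem posDef_gram (g : Metric n M) {x : M} {y : Coord n}
    (hy : y ∈ (extChartAt (𝓡∂ n) x).target) : (gram g x y).PosDef := by
  refine Matrix.PosDef.of_dotProduct_mulVec_pos ?_ fun c hc ↦ ?_
  · ext i j
    rw [Matrix.conjTranspose_apply, star_trivial]
    exact g.symm _ _ _
  · set v : Coord n := WithLp.toLp 2 c with hv
    have hv0 : v ≠ 0 := fun h ↦ hc (by simpa [hv] using h)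
    have hf0 : frame x y v ≠ 0 := fun h ↦ hv0 (injective_frame hy (by rw [h, map_zero]))
    have hpos : 0 < metricForm g ((extChartAt (𝓡∂ n) x).symm y) (frame x y v) (frame x y v) :=
      g.pos _ _ hf0
    have hsum : frame x y v = ∑ i, c i • frame x y (EuclideanSpace.single i 1) := by
      conv_lhs => rw [← (EuclideanSpace.basisFun (Fin n) ℝ).sum_repr v]
      simp [hv]
    have : metricForm g ((extChartAt (𝓡∂ n) x).symm y) (frame x y v) (frame x y v)
        = star c ⬝ᵥ (gram g x y).mulVec c := by
      rw [hsum]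
      simp only [map_sum, map_smul, sum_apply, smul_apply, smul_eq_mul, dotProduct,
        Matrix.mulVec, gram_apply, Pi.star_apply, star_trivial, Finset.mul_sum]
      rw [Finset.sum_comm]
      exact Finset.sum_congr rfl fun i _ ↦ Finset.sum_congr rfl fun j _ ↦ by ring
    rwa [this] at hpos

theorem det_gram_pos (g : Metric n M) {x : M} {y : Coord n}
    (hy : y ∈ (extChartAt (𝓡∂ n) x).target) : 0 < (gram g x y).det := (posDef_gram g hy).det_pos

/-- The coordinate vector fields `d(φ⁻¹) eᵢ` are smooth sections of `TM` along `φ⁻¹`, so their inner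
products are smooth. -/
theorem contDiffOn_gram (g : Metric n M) (x : M) (i j : Fin n) :
    ContDiffOn ℝ ∞ (fun y ↦ gram g x y i j) (extChartAt (𝓡∂ n) x).target := by
  have hI : IsManifold (𝓡∂ n) 1 M := IsManifold.of_le (n := ∞) (by simp)
  rw [← contMDiffOn_iff_contDiffOn]
  have hsymm : ContMDiffOn 𝓘(ℝ, Coord n) (𝓡∂ n) ∞ (extChartAt (𝓡∂ n) x).symm
    (extChartAt (𝓡∂ n) x).target := contMDiffOn_extChartAt_symm x
  have huniq : UniqueMDiffOn 𝓘(ℝ, Coord n) (extChartAt (𝓡∂ n) x).target :=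
    (uniqueDiffOn_extChartAt_target x).uniqueMDiffOn
  have hvec : ∀ i : Fin n, ContMDiffOn 𝓘(ℝ, Coord n) (𝓡∂ n).tangent ∞
      (fun y ↦ (⟨(extChartAt (𝓡∂ n) x).symm y, frame x y (EuclideanSpace.single i 1)⟩ :
        TangentBundle (𝓡∂ n) M)) (extChartAt (𝓡∂ n) x).target := by
    intro i
    have h1 := hsymm.contMDiffOn_tangentMapWithin (m := ∞) (by simp) huniq
    have h2 : ContMDiff 𝓘(ℝ, Coord n) (𝓘(ℝ, Coord n)).tangent ∞
        (fun y ↦ (⟨y, EuclideanSpace.single i 1⟩ : TangentBundle 𝓘(ℝ, Coord n) (Coord n))) :=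
      contMDiff_vectorSpace_iff_contDiff.2 contDiff_const
    refine (h1.comp h2.contMDiffOn fun y hy ↦ hy).congr fun y hy ↦ ?_
    have h3 : frame x y = mfderivWithin 𝓘(ℝ, Coord n) (𝓡∂ n) (extChartAt (𝓡∂ n) x).symm
        (extChartAt (𝓡∂ n) x).target y :=
      (((mdifferentiableWithinAt_extChartAt_symm hy).hasMFDerivWithinAt.mono
        (target_subset_range x)).mfderivWithin (huniq y hy)).symm
    rw [h3]
    rfl
  intro y hy
  have := ContMDiffWithinAt.clm_bundle_apply₂ (F₁ := Coord n) (F₂ := Coord n) (F₃ := ℝ)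
    (E₃ := Bundle.Trivial M ℝ) (n := ∞)
    (g.contMDiff.contMDiffAt.comp_contMDiffWithinAt y (hsymm y hy)) (hvec i y hy) (hvec j y hy)
  simp only [contMDiffWithinAt_totalSpace] at this
  exact this.2

end Charts

/-! ### The Riemannian measures in charts -/

section Parametrization

variable {X M : Type*} [TopologicalSpace X] [MeasureSpace X] [BorelSpace X]
  [TopologicalSpace M] [MeasurableSpace M] [BorelSpace M]

/-- The measure `ρ dy` on `T`, carried to `M` by the parametrization `P`. -/
def paramMeasure (T : Set X) (P : X → M) (ρ : X → ℝ) : Measure M :=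
  ((volume.restrict T).withDensity fun y ↦ ENNReal.ofReal (ρ y)).map P

variable {T : Set X} {P : X → M} {ρ : X → ℝ}

theorem aemeasurable_param (hT : MeasurableSet T) (hP : ContinuousOn P T) :
    AEMeasurable P ((volume.restrict T).withDensity fun y ↦ ENNReal.ofReal (ρ y)) :=
  (hP.aemeasurable hT).mono_ac (withDensity_absolutelyContinuous _ _)

theorem measurableSet_preimage_inter (hT : MeasurableSet T) (hP : ContinuousOn P T) {A : Set M}
    (hA : MeasurableSet A) : MeasurableSet (P ⁻¹' A ∩ T) := by
  have h := MeasurableSet.subtype_image hT (hP.domRestrict.measurable hA)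
  convert h using 1
  ext y
  simp only [mem_inter_iff, mem_preimage, mem_image, Subtype.exists, domRestrict_apply,
    exists_and_right, exists_eq_right]
  exact ⟨fun h ↦ ⟨h.2, h.1⟩, fun ⟨h1, h2⟩ ↦ ⟨h2, h1⟩⟩

variable [SFinite (volume : Measure X)]

theorem paramMeasure_apply (hT : MeasurableSet T) (hP : ContinuousOn P T) {A : Set M}
    (hA : MeasurableSet A) :
    paramMeasure T P ρ A = ∫⁻ y in P ⁻¹' A ∩ T, ENNReal.ofReal (ρ y) := by
  rw [paramMeasure, Measure.map_apply_of_aemeasurable (aemeasurable_param hT hP) hA,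
    withDensity_apply', Measure.restrict_restrict' hT]

theorem paramMeasure_compl_eq_zero (hT : MeasurableSet T) (hP : ContinuousOn P T) {S : Set M}
    (hS : MeasurableSet S) (hPS : MapsTo P T S) : paramMeasure T P ρ Sᶜ = 0 := by
  rw [paramMeasure_apply hT hP hS.compl]
  have : P ⁻¹' Sᶜ ∩ T = ∅ := by
    ext y
    simp only [mem_inter_iff, mem_preimage, mem_compl_iff, mem_empty_iff_false, iff_false, not_and]
    exact fun h hy ↦ h (hPS hy)
  rw [this, Measure.restrict_empty, lintegral_zero_measure]

/-- Integration against `paramMeasure` in the coordinates of the parametrization, whose inverse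
on `S` is the continuous map `Q`. The inverse transfers the measurability of `f ∘ P` to `f`, so that
no measurability of `f` has to be assumed. -/
theorem integrable_paramMeasure (hT : MeasurableSet T) (hP : ContinuousOn P T) {S : Set M}
    (hS : MeasurableSet S) (hPS : MapsTo P T S) {Q : M → X} (hQ : ContinuousOn Q S)
    (hQP : ∀ y ∈ T, Q (P y) = y) (hPQ : ∀ p ∈ S, P (Q p) = p) (hρ : ContinuousOn ρ T)
    (hρ0 : ∀ y ∈ T, 0 ≤ ρ y) {f : M → ℝ} (hf : IntegrableOn (fun y ↦ ρ y * f (P y)) T) :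
    Integrable f (paramMeasure T P ρ) ∧
      ∫ p, f p ∂(paramMeasure T P ρ) = ∫ y in T, ρ y * f (P y) := by
  set ν := (volume.restrict T).withDensity fun y ↦ ENNReal.ofReal (ρ y) with hν
  have hρm : AEMeasurable (fun y ↦ ENNReal.ofReal (ρ y)) (volume.restrict T) :=
    (hρ.aemeasurable hT).ennreal_ofReal
  have hfin : ∀ᵐ y ∂(volume.restrict T), ENNReal.ofReal (ρ y) < ⊤ :=
    Filter.Eventually.of_forall fun y ↦ ENNReal.ofReal_lt_top
  have hae : ∀ᵐ y ∂(volume.restrict T),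
      (ENNReal.ofReal (ρ y)).toReal • f (P y) = ρ y * f (P y) := by
    filter_upwards [ae_restrict_mem hT] with y hy
    rw [ENNReal.toReal_ofReal (hρ0 y hy), smul_eq_mul]
  have hint : Integrable (f ∘ P) ν := by
    rw [hν, integrable_withDensity_iff_integrable_smul₀' hρm hfin]
    exact (integrable_congr hae).2 hf
  have hPm : AEMeasurable P ν := aemeasurable_param hT hP
  have hmem : ∀ᵐ p ∂(ν.map P), p ∈ S := by
    rw [ae_iff]; exact paramMeasure_compl_eq_zero hT hP hS hPS
  have hQm : AEMeasurable Q (ν.map P) := by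
    rw [← Measure.restrict_eq_self_of_ae_mem hmem]
    exact hQ.aemeasurable hS
  have hback : (ν.map P).map Q = ν := by
    rw [AEMeasurable.map_map_of_aemeasurable hQm hPm]
    have : Q ∘ P =ᵐ[ν] id := by
      refine (withDensity_absolutelyContinuous _ _).ae_le ?_
      filter_upwards [ae_restrict_mem hT] with y hy using hQP y hy
    rw [Measure.map_congr this, Measure.map_id]
  have hfm : AEStronglyMeasurable f (ν.map P) := by
    have h1 : AEStronglyMeasurable ((f ∘ P) ∘ Q) (ν.map P) :=
      AEStronglyMeasurable.comp_aemeasurable (by rw [hback]; exact hint.aestronglyMeasurable) hQm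
    refine h1.congr ?_
    filter_upwards [hmem] with p hp
    simp [hPQ p hp]
  refine ⟨(integrable_map_measure hfm hPm).2 hint, ?_⟩
  rw [paramMeasure, integral_map hPm hfm, integral_withDensity_eq_integral_toReal_smul₀ hρm hfin]
  exact integral_congr_ae hae

end Parametrization

/-- Two parametrizations related by a change of variables induce the same measure. -/
theorem paramMeasure_eq_of_changeOfVariables {X M : Type*} [NormedAddCommGroup X]
    [NormedSpace ℝ X] [FiniteDimensional ℝ X] [MeasureSpace X] [BorelSpace X]
    [(volume : Measure X).IsAddHaarMeasure]
    [TopologicalSpace M] [MeasurableSpace M] [BorelSpace M]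
    {T T' : Set X} {P P' : X → M} {ρ ρ' : X → ℝ}
    (hT : MeasurableSet T) (hP : ContinuousOn P T) (hT' : MeasurableSet T')
    (hP' : ContinuousOn P' T') {A : Set M} (hA : MeasurableSet A)
    {ψ : X → X} {ψ' : X → X →L[ℝ] X}
    (hd : ∀ y ∈ P ⁻¹' A ∩ T, HasFDerivWithinAt ψ (ψ' y) (P ⁻¹' A ∩ T) y)
    (hinj : InjOn ψ (P ⁻¹' A ∩ T)) (himage : ψ '' (P ⁻¹' A ∩ T) = P' ⁻¹' A ∩ T')
    (hρ : ∀ y ∈ P ⁻¹' A ∩ T, ρ y = |(ψ' y).det| * ρ' (ψ y)) :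
    paramMeasure T P ρ A = paramMeasure T' P' ρ' A := by
  have hs := measurableSet_preimage_inter hT hP hA
  rw [paramMeasure_apply hT hP hA, paramMeasure_apply hT' hP' hA, ← himage,
    lintegral_image_eq_lintegral_abs_det_fderiv_mul volume hs hd hinj]
  refine setLIntegral_congr_fun hs fun y hy ↦ ?_
  rw [hρ y hy, ENNReal.ofReal_mul (abs_nonneg _)]

section Measures

variable {n : ℕ} [NeZero n] {M : Type*} [TopologicalSpace M]
  [ChartedSpace (EuclideanHalfSpace n) M]

theorem preimage_inter_target_subset_overlap {x x' : M} {A : Set M}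
    (hA : A ⊆ (extChartAt (𝓡∂ n) x).source ∩ (extChartAt (𝓡∂ n) x').source) :
    (extChartAt (𝓡∂ n) x).symm ⁻¹' A ∩ (extChartAt (𝓡∂ n) x).target ⊆ overlap x x' :=
  fun _ hy ↦ mem_overlap.2 ⟨hy.2, (hA hy.1).2⟩

/-- The map induced by the transition map on the coordinates of the boundary hyperplane. -/
def bdryTransition (x x' : M) (z : {i : Fin n // i ≠ 0} → ℝ) : {i : Fin n // i ≠ 0} → ℝ :=
  fun a ↦ transition x x' (bdryIncl z) a

/-- The embedding `bdryIncl` as a continuous linear map. -/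
def bdryInclL : ({i : Fin n // i ≠ 0} → ℝ) →L[ℝ] Coord n :=
  LinearMap.toContinuousLinearMap
    { toFun := bdryIncl
      map_add' := fun z w ↦ by
        ext i
        by_cases h : i = 0
        · simp [bdryIncl, h]
        · simp [bdryIncl, h]
      map_smul' := fun c z ↦ by
        ext i
        by_cases h : i = 0
        · simp [bdryIncl, h]
        · simp [bdryIncl, h] }

theorem bdryIncl_single (b : {i : Fin n // i ≠ 0}) :
    bdryIncl (Pi.single b (1 : ℝ)) = EuclideanSpace.single (b : Fin n) (1 : ℝ) := by
  ext i
  by_cases h : i = 0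
  · subst h
    rw [bdryIncl_apply_zero]
    simp [b.2.symm]
  · have := bdryIncl_apply_coe (Pi.single b (1 : ℝ)) ⟨i, h⟩
    rw [this]
    by_cases hb : i = b
    · subst hb; simp
    · rw [Pi.single_eq_of_ne (fun h' ↦ hb (congrArg Subtype.val h'))]
      simp [hb]

/-- The derivative of `bdryTransition`. -/
def bdryTransitionDeriv (x x' : M) (z : {i : Fin n // i ≠ 0} → ℝ) :
    ({i : Fin n // i ≠ 0} → ℝ) →L[ℝ] ({i : Fin n // i ≠ 0} → ℝ) :=
  ContinuousLinearMap.pi fun a ↦ (EuclideanSpace.proj (a : Fin n) : Coord n →L[ℝ] ℝ).comp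
    ((transitionDeriv x x' (bdryIncl z)).comp bdryInclL)

theorem det_bdryTransitionDeriv (x x' : M) (z : {i : Fin n // i ≠ 0} → ℝ) :
    (bdryTransitionDeriv x x' z).det =
      ((transitionMatrix x x' (bdryIncl z)).submatrix Subtype.val Subtype.val :
        Matrix {i : Fin n // i ≠ 0} {i : Fin n // i ≠ 0} ℝ).det := by
  rw [ContinuousLinearMap.det, ← LinearMap.det_toMatrix']
  congr 1
  ext a b
  rw [LinearMap.toMatrix'_apply]
  change transitionDeriv x x' (bdryIncl z) (bdryIncl _) a = _
  rw [bdryIncl_single]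
  rfl

theorem bdryIncl_injective : Function.Injective (bdryIncl (n := n)) := fun z w h ↦ by
  funext a
  rw [← bdryIncl_apply_coe z, h, bdryIncl_apply_coe]

theorem isOpen_source (x : M) : IsOpen (extChartAt (𝓡∂ n) x).source := isOpen_extChartAt_source x

theorem continuousOn_symm_comp_bdryIncl (x : M) :
    ContinuousOn (fun z ↦ (extChartAt (𝓡∂ n) x).symm (bdryIncl z))
      (bdryIncl ⁻¹' (extChartAt (𝓡∂ n) x).target) :=
  (continuousOn_extChartAt_symm x).comp continuous_bdryIncl.continuousOn fun _ h ↦ h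

theorem measurableSet_bdryIncl_preimage_target (x : M) :
    MeasurableSet (bdryIncl ⁻¹' (extChartAt (𝓡∂ n) x).target) :=
  continuous_bdryIncl.measurable (measurableSet_target x)

variable [IsManifold (𝓡∂ n) ∞ M]

/-- The density `√(det g)` transforms by the absolute value of the Jacobian determinant. -/
theorem sqrt_det_gram (g : Metric n M) {x x' : M} {y : Coord n} (hy : y ∈ overlap x x') :
    √(gram g x y).det = |(transitionMatrix x x' y).det| *
      √(gram g x' (transition x x' y)).det := by
  rw [gram_eq_transpose_mul g hy, Matrix.det_mul, Matrix.det_mul, Matrix.det_transpose,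
    mul_right_comm, ← sq, Real.sqrt_mul (sq_nonneg _), Real.sqrt_sq_eq_abs]

theorem hasFDerivWithinAt_bdryTransition {x x' : M} {z : {i : Fin n // i ≠ 0} → ℝ}
    (hz : bdryIncl z ∈ overlap x x') (s : Set ({i : Fin n // i ≠ 0} → ℝ)) :
    HasFDerivWithinAt (bdryTransition x x') (bdryTransitionDeriv x x' z) s z := by
  refine hasFDerivWithinAt_pi.2 fun a ↦ ?_
  exact (EuclideanSpace.proj (a : Fin n) : Coord n →L[ℝ] ℝ).hasFDerivAt.comp_hasFDerivWithinAt z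
    ((hasFDerivWithinAt_transition hz).comp z (bdryInclL.hasFDerivAt.hasFDerivWithinAt)
      fun w _ ↦ bdryIncl_mem_range w)

theorem bdryIncl_bdryTransition {x x' : M} {z : {i : Fin n // i ≠ 0} → ℝ}
    (hz : bdryIncl z ∈ overlap x x') :
    bdryIncl (bdryTransition x x' z) = transition x x' (bdryIncl z) := by
  ext i
  by_cases h : i = 0
  · rw [h, bdryIncl_apply_zero, (transition_apply_zero_iff hz).2 (bdryIncl_apply_zero z)]
  · exact bdryIncl_apply_coe _ ⟨i, h⟩

/-- On the hyperplane the tangential block transforms by the tangential block of the Jacobian. -/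
theorem gramTan_eq_transpose_mul (g : Metric n M) {x x' : M} {y : Coord n}
    (hy : y ∈ overlap x x') (hy0 : y 0 = 0) :
    gramTan g x y = ((transitionMatrix x x' y).submatrix Subtype.val Subtype.val).transpose *
      gramTan g x' (transition x x' y) *
      (transitionMatrix x x' y).submatrix Subtype.val Subtype.val := by
  have hsum : ∀ f : Fin n → ℝ, f 0 = 0 → ∑ i, f i = ∑ a : {i : Fin n // i ≠ 0}, f a := by
    intro f hf
    rw [Fintype.sum_eq_add_sum_subtype_ne f 0, hf, zero_add]
  ext a b
  rw [gramTan, Matrix.submatrix_apply, gram_eq_transpose_mul g hy]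
  simp only [Matrix.mul_apply, Matrix.transpose_apply, Matrix.submatrix_apply, gramTan]
  rw [hsum _ (by simp [transitionMatrix_zero_of_ne hy hy0 b.2])]
  refine Finset.sum_congr rfl fun c _ ↦ ?_
  rw [hsum _ (by simp [transitionMatrix_zero_of_ne hy hy0 a.2])]

theorem sqrt_det_gramTan (g : Metric n M) {x x' : M} {z : {i : Fin n // i ≠ 0} → ℝ}
    (hz : bdryIncl z ∈ overlap x x') :
    √(gramTan g x (bdryIncl z)).det = |(bdryTransitionDeriv x x' z).det| *
      √(gramTan g x' (bdryIncl (bdryTransition x x' z))).det := by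
  rw [gramTan_eq_transpose_mul g hz (bdryIncl_apply_zero z), bdryIncl_bdryTransition hz,
    det_bdryTransitionDeriv, Matrix.det_mul, Matrix.det_mul, Matrix.det_transpose,
    mul_right_comm, ← sq, Real.sqrt_mul (sq_nonneg _), Real.sqrt_sq_eq_abs]

theorem mapsTo_symm_comp_bdryIncl (x : M) :
    MapsTo (fun z ↦ (extChartAt (𝓡∂ n) x).symm (bdryIncl z))
      (bdryIncl ⁻¹' (extChartAt (𝓡∂ n) x).target)
      ((extChartAt (𝓡∂ n) x).source ∩ (𝓡∂ n).boundary M) := fun z hz ↦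
  ⟨(extChartAt (𝓡∂ n) x).map_target hz, (symm_mem_boundary_iff hz).2 (bdryIncl_apply_zero z)⟩

variable [MeasurableSpace M]

theorem chartVolume_eq (g : Metric n M) (x : M) :
    chartVolume g x = paramMeasure (extChartAt (𝓡∂ n) x).target (extChartAt (𝓡∂ n) x).symm
      fun y ↦ √(gram g x y).det := rfl

theorem chartArea_eq (g : Metric n M) (x : M) :
    chartArea g x = paramMeasure (bdryIncl ⁻¹' (extChartAt (𝓡∂ n) x).target)
      (fun z ↦ (extChartAt (𝓡∂ n) x).symm (bdryIncl z))
      fun z ↦ √(gramTan g x (bdryIncl z)).det := rfl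

variable [BorelSpace M]

theorem measurableSet_boundary : MeasurableSet ((𝓡∂ n).boundary M) :=
  ((𝓡∂ n).isClosed_boundary (n := ∞) (by simp)).measurableSet

theorem chartVolume_agree (g : Metric n M) (x x' : M) {A : Set M} (hA : MeasurableSet A)
    (hAS : A ⊆ (extChartAt (𝓡∂ n) x).source ∩ (extChartAt (𝓡∂ n) x').source) :
    chartVolume g x A = chartVolume g x' A := by
  have hsub := preimage_inter_target_subset_overlap hAS
  have hsub' := preimage_inter_target_subset_overlap (x := x') (x' := x)
    (hAS.trans (inter_comm _ _).subset)
  rw [chartVolume_eq, chartVolume_eq]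
  refine paramMeasure_eq_of_changeOfVariables (measurableSet_target x)
    (continuousOn_extChartAt_symm x) (measurableSet_target x') (continuousOn_extChartAt_symm x') hA
    (ψ := transition x x') (ψ' := transitionDeriv x x') (fun y hy ↦ ?_) ?_ ?_ fun y hy ↦ ?_
  · exact (hasFDerivWithinAt_transition (hsub hy)).mono fun z hz ↦ target_subset_range x hz.2
  · exact (injOn_transition x x').mono hsub
  · refine Subset.antisymm ?_ fun y hy ↦ ?_
    · rintro _ ⟨y, hy, rfl⟩
      refine ⟨?_, mem_target_of_mem_overlap (transition_mem_overlap (hsub hy))⟩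
      rw [mem_preimage, symm_transition (hsub hy)]
      exact hy.1
    · refine ⟨transition x' x y, ⟨?_, ?_⟩, transition_transition (hsub' hy)⟩
      · rw [mem_preimage, symm_transition (hsub' hy)]
        exact hy.1
      · exact mem_target_of_mem_overlap (transition_mem_overlap (hsub' hy))
  · rw [sqrt_det_gram g (hsub hy), transitionMatrix, det_coordMatrix]

theorem chartArea_agree (g : Metric n M) (x x' : M) {A : Set M} (hA : MeasurableSet A)
    (hAS : A ⊆ (extChartAt (𝓡∂ n) x).source ∩ (extChartAt (𝓡∂ n) x').source) :
    chartArea g x A = chartArea g x' A := by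
  have hsub : ∀ z ∈ (fun z ↦ (extChartAt (𝓡∂ n) x).symm (bdryIncl z)) ⁻¹' A ∩
      bdryIncl ⁻¹' (extChartAt (𝓡∂ n) x).target, bdryIncl z ∈ overlap x x' := fun z hz ↦
    preimage_inter_target_subset_overlap hAS hz
  have hsub' : ∀ z ∈ (fun z ↦ (extChartAt (𝓡∂ n) x').symm (bdryIncl z)) ⁻¹' A ∩
      bdryIncl ⁻¹' (extChartAt (𝓡∂ n) x').target, bdryIncl z ∈ overlap x' x := fun z hz ↦
    preimage_inter_target_subset_overlap (hAS.trans (inter_comm _ _).subset) hz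
  have htt : ∀ (x x' : M) (z : {i : Fin n // i ≠ 0} → ℝ), bdryIncl z ∈ overlap x x' →
      bdryTransition x' x (bdryTransition x x' z) = z := fun x x' z hz ↦ by
    refine bdryIncl_injective ?_
    have h1 := bdryIncl_bdryTransition hz
    rw [bdryIncl_bdryTransition (by rw [h1]; exact transition_mem_overlap hz), h1,
      transition_transition hz]
  rw [chartArea_eq, chartArea_eq]
  refine paramMeasure_eq_of_changeOfVariables (measurableSet_bdryIncl_preimage_target x)
    (continuousOn_symm_comp_bdryIncl x) (measurableSet_bdryIncl_preimage_target x')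
    (continuousOn_symm_comp_bdryIncl x') hA
    (ψ := bdryTransition x x') (ψ' := bdryTransitionDeriv x x') (fun z hz ↦ ?_) ?_ ?_
    fun z hz ↦ ?_
  · exact hasFDerivWithinAt_bdryTransition (hsub z hz) _
  · intro z hz w hw h
    rw [← htt x x' z (hsub z hz), h, htt x x' w (hsub w hw)]
  · refine Subset.antisymm ?_ fun z hz ↦ ?_
    · rintro _ ⟨z, hz, rfl⟩
      have h1 := bdryIncl_bdryTransition (hsub z hz)
      refine ⟨?_, ?_⟩
      · change (extChartAt (𝓡∂ n) x').symm (bdryIncl _) ∈ A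
        rw [h1, symm_transition (hsub z hz)]
        exact hz.1
      · rw [mem_preimage, h1]
        exact mem_target_of_mem_overlap (transition_mem_overlap (hsub z hz))
    · have h1 := bdryIncl_bdryTransition (hsub' z hz)
      refine ⟨bdryTransition x' x z, ⟨?_, ?_⟩, htt x' x z (hsub' z hz)⟩
      · change (extChartAt (𝓡∂ n) x).symm (bdryIncl _) ∈ A
        rw [h1, symm_transition (hsub' z hz)]
        exact hz.1
      · rw [mem_preimage, h1]
        exact mem_target_of_mem_overlap (transition_mem_overlap (hsub' z hz))
  · exact sqrt_det_gramTan g (hsub z hz)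

/-- On the domain of a chart the supremum defining `dv_g` is the measure of that chart. -/
theorem volumeMeasure_restrict_source (g : Metric n M) (x : M) :
    (volumeMeasure g).restrict (extChartAt (𝓡∂ n) x).source = chartVolume g x :=
  iSup_restrict_eq (fun x ↦ (isOpen_source (n := n) x).measurableSet)
    (fun x ↦ paramMeasure_compl_eq_zero (measurableSet_target x) (continuousOn_extChartAt_symm x)
      (isOpen_source x).measurableSet (extChartAt (𝓡∂ n) x).mapsTo_symm)
    (fun x x' _ hA hAS ↦ chartVolume_agree g x x' hA hAS) x

/-- On the boundary part of the domain of a chart the supremum defining `dσ_g` is the measure of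
that chart. -/
theorem boundaryMeasure_restrict_source (g : Metric n M) (x : M) :
    (boundaryMeasure g).restrict ((extChartAt (𝓡∂ n) x).source ∩ (𝓡∂ n).boundary M)
      = chartArea g x :=
  iSup_restrict_eq (S := fun x ↦ (extChartAt (𝓡∂ n) x).source ∩ (𝓡∂ n).boundary M)
    (fun x ↦ (isOpen_source x).measurableSet.inter measurableSet_boundary)
    (fun x ↦ paramMeasure_compl_eq_zero (measurableSet_bdryIncl_preimage_target x)
      (continuousOn_symm_comp_bdryIncl x)
      ((isOpen_source x).measurableSet.inter measurableSet_boundary)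
      (mapsTo_symm_comp_bdryIncl x))
    (fun x x' _ hA hAS ↦ chartArea_agree g x x' hA fun _ hp ↦ ⟨(hAS hp).1.1, (hAS hp).2.1⟩) x

end Measures

/-! ### Gradient, Laplacian and normal derivative in charts -/

section Gradient

variable {n : ℕ} [NeZero n] {M : Type*} [TopologicalSpace M]
  [ChartedSpace (EuclideanHalfSpace n) M]

theorem pd_eq_fderiv {y : Coord n} (hy : 0 < y 0) (i : Fin n) (f : Coord n → ℝ) :
    pd i f y = fderiv ℝ f y (EuclideanSpace.single i 1) := by
  have : range (𝓡∂ n) ∈ nhds y := by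
    rw [← mem_interior_iff_mem_nhds, interior_range_modelWithCornersEuclideanHalfSpace]
    exact hy
  rw [pd, fderivWithin_of_mem_nhds this]

theorem pd_congr {f f' : Coord n → ℝ} {y : Coord n} (hy : y ∈ range (𝓡∂ n))
    (h : f =ᶠ[nhdsWithin y (range (𝓡∂ n))] f') (i : Fin n) : pd i f y = pd i f' y := by
  rw [pd, h.fderivWithin_eq (h.self_of_nhdsWithin hy), pd]

theorem pd_fun_sum {ι : Type*} {s : Finset ι} {f : ι → Coord n → ℝ} {y : Coord n}
    (hy : y ∈ range (𝓡∂ n)) (hf : ∀ k ∈ s, DifferentiableWithinAt ℝ (f k) (range (𝓡∂ n)) y)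
    (i : Fin n) : pd i (fun z ↦ ∑ k ∈ s, f k z) y = ∑ k ∈ s, pd i (f k) y := by
  have := (HasFDerivWithinAt.fun_sum fun k hk ↦ (hf k hk).hasFDerivWithinAt).fderivWithin
    (uniqueDiffOn_range_model y hy)
  rw [pd, this, sum_apply]
  rfl

theorem comp_sum_symm {ι : Type*} (s : Finset ι) (v : ι → M → ℝ) (x : M) :
    (fun q ↦ ∑ k ∈ s, v k q) ∘ (extChartAt (𝓡∂ n) x).symm
      = fun z ↦ ∑ k ∈ s, (v k ∘ (extChartAt (𝓡∂ n) x).symm) z := rfl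

variable [IsManifold (𝓡∂ n) ∞ M]

/-- The components `gⁱʲ ∂ⱼ u` of the gradient of `u` in the chart around `x`. -/
def gradient (g : Metric n M) (u : M → ℝ) (x : M) (y : Coord n) : Fin n → ℝ :=
  (gram g x y)⁻¹.mulVec fun j ↦ pd j (u ∘ (extChartAt (𝓡∂ n) x).symm) y

/-- The components of the vector density `(det g)^{1/2} ∇u` in the chart around `x`. -/
def flux (g : Metric n M) (u : M → ℝ) (x : M) (i : Fin n) (y : Coord n) : ℝ :=
  √(gram g x y).det * gradient g u x y i

theorem laplacian_eq (g : Metric n M) (u : M → ℝ) (x : M) :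
    laplacian g u x = -((√(gram g x (extChartAt (𝓡∂ n) x x)).det)⁻¹ *
      ∑ i, pd i (flux g u x i) (extChartAt (𝓡∂ n) x x)) := rfl

theorem isSymm_inv_gram (g : Metric n M) (x : M) (y : Coord n) (i j : Fin n) :
    (gram g x y)⁻¹ i j = (gram g x y)⁻¹ j i := by
  have h : (gram g x y).transpose = gram g x y := by
    ext i j
    exact g.symm _ _ _
  rw [← Matrix.transpose_apply (gram g x y)⁻¹ j i, Matrix.transpose_nonsing_inv, h]

theorem normalDeriv_eq_gradient (g : Metric n M) (u : M → ℝ) (x : M) :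
    normalDeriv g u x = -(gradient g u x (extChartAt (𝓡∂ n) x x) 0 /
      √((gram g x (extChartAt (𝓡∂ n) x x))⁻¹ 0 0)) := by
  simp only [normalDeriv, normal, gradient, Matrix.mulVec, dotProduct, Finset.sum_div]
  rw [← Finset.sum_neg_distrib]
  refine Finset.sum_congr rfl fun i _ ↦ ?_
  rw [isSymm_inv_gram g x _ i 0]
  ring

theorem contDiffWithinAt_comp_symm {u : M → ℝ} {k : ℕ∞} (hu : ContMDiff (𝓡∂ n) 𝓘(ℝ, ℝ) k u)
    {x : M} {y : Coord n} (hy : y ∈ (extChartAt (𝓡∂ n) x).target) :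
    ContDiffWithinAt ℝ k (u ∘ (extChartAt (𝓡∂ n) x).symm) (range (𝓡∂ n)) y := by
  have h1 : ContMDiffWithinAt 𝓘(ℝ, Coord n) (𝓡∂ n) ∞ (extChartAt (𝓡∂ n) x).symm
      (range (𝓡∂ n)) y := (contMDiffOn_extChartAt_symm x y hy).mono_of_mem_nhdsWithin
        (target_mem_nhdsWithin hy)
  have h2 : ContMDiffWithinAt 𝓘(ℝ, Coord n) 𝓘(ℝ, ℝ) k (u ∘ (extChartAt (𝓡∂ n) x).symm)
      (range (𝓡∂ n)) y :=
    hu.contMDiffAt.comp_contMDiffWithinAt y (h1.of_le (by exact_mod_cast le_top))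
  exact contMDiffWithinAt_iff_contDiffWithinAt.1 h2

theorem contDiffWithinAt_gram (g : Metric n M) {x : M} {y : Coord n}
    (hy : y ∈ (extChartAt (𝓡∂ n) x).target) (i j : Fin n) :
    ContDiffWithinAt ℝ 1 (fun z ↦ gram g x z i j) (range (𝓡∂ n)) y :=
  ((contDiffOn_gram g x i j y hy).mono_of_mem_nhdsWithin (target_mem_nhdsWithin hy)).of_le
    (by exact_mod_cast le_top)

theorem contDiffWithinAt_pd_comp_symm {u : M → ℝ} (hu : ContMDiff (𝓡∂ n) 𝓘(ℝ, ℝ) 2 u)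
    {x : M} {y : Coord n} (hy : y ∈ (extChartAt (𝓡∂ n) x).target) (j : Fin n) :
    ContDiffWithinAt ℝ 1 (pd j (u ∘ (extChartAt (𝓡∂ n) x).symm)) (range (𝓡∂ n)) y :=
  ((contDiffWithinAt_comp_symm (k := 2) hu hy).fderivWithin_right uniqueDiffOn_range_model
    (m := 1) (by norm_num) (target_subset_range x hy)).clm_apply contDiffWithinAt_const

/-- For `u` of class `C²` the flux is `C¹` up to the boundary. -/
theorem contDiffWithinAt_flux (g : Metric n M) {u : M → ℝ} (hu : ContMDiff (𝓡∂ n) 𝓘(ℝ, ℝ) 2 u)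
    {x : M} {y : Coord n} (hy : y ∈ (extChartAt (𝓡∂ n) x).target) (i : Fin n) :
    ContDiffWithinAt ℝ 1 (flux g u x i) (range (𝓡∂ n)) y := by
  have hdet := (det_gram_pos g hy).ne'
  have hG := contDiffWithinAt_gram g hy
  refine ((ContDiffWithinAt.matrix_det hG).sqrt hdet).mul ?_
  simp only [gradient, Matrix.mulVec, dotProduct]
  exact ContDiffWithinAt.sum fun j _ ↦ (ContDiffWithinAt.matrix_inv hG hdet i j).mul
    (contDiffWithinAt_pd_comp_symm hu hy j)

/-! ### Change of charts -/

/-- The gradient is a contravariant vector. -/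
theorem gradient_transition (g : Metric n M) {u : M → ℝ} (hu : ContMDiff (𝓡∂ n) 𝓘(ℝ, ℝ) 2 u)
    {x x' : M} {y : Coord n} (hy : y ∈ overlap x x') :
    gradient g u x' (transition x x' y) = (transitionMatrix x x' y).mulVec (gradient g u x y) := by
  have hdet : IsUnit (transitionMatrix x x' y).det := (det_transitionMatrix_ne_zero hy).isUnit
  have hdet' : IsUnit (transitionMatrix x x' y).transpose.det := by
    rwa [Matrix.det_transpose]
  have hty := mem_target_of_mem_overlap (transition_mem_overlap hy)
  have hdiff := (contDiffWithinAt_comp_symm (k := 2) hu hty).differentiableWithinAt (by norm_num)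
  have hcongr : u ∘ (extChartAt (𝓡∂ n) x).symm =ᶠ[nhdsWithin y (range (𝓡∂ n))]
      (u ∘ (extChartAt (𝓡∂ n) x').symm) ∘ transition x x' := by
    filter_upwards [overlap_mem_nhdsWithin hy] with z hz
    simp only [Function.comp_apply, symm_transition hz]
  have hp : (fun j ↦ pd j (u ∘ (extChartAt (𝓡∂ n) x).symm) y)
      = (transitionMatrix x x' y).transpose.mulVec
        fun b ↦ pd b (u ∘ (extChartAt (𝓡∂ n) x').symm) (transition x x' y) := by
    funext j
    rw [pd_congr (mem_range_of_mem_overlap hy) hcongr, pd,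
      (hasFDerivWithinAt_comp_transition hy hdiff).fderivWithin
        (uniqueDiffOn_range_model y (mem_range_of_mem_overlap hy))]
    exact apply_eq_sum_coordMatrix (fderivWithin ℝ (u ∘ (extChartAt (𝓡∂ n) x').symm)
      (range (𝓡∂ n)) (transition x x' y)).toLinearMap (transitionDeriv x x' y) j
  rw [gradient, gradient, hp, gram_eq_transpose_mul g hy, Matrix.mul_inv_rev, Matrix.mul_inv_rev,
    Matrix.mulVec_mulVec, Matrix.mulVec_mulVec]
  congr 1
  simp only [Matrix.mul_assoc]
  rw [Matrix.nonsing_inv_mul _ hdet', Matrix.mul_one, ← Matrix.mul_assoc,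
    Matrix.mul_nonsing_inv _ hdet, Matrix.one_mul]

/-- The flux transforms by the adjugate of the Jacobian, up to the sign that makes up for the
absolute value in `sqrt_det_gram`. -/
theorem flux_transition (g : Metric n M) {u : M → ℝ} (hu : ContMDiff (𝓡∂ n) 𝓘(ℝ, ℝ) 2 u)
    {x x' : M} {y : Coord n} (hy : y ∈ overlap x x') (i : Fin n) :
    flux g u x i y = SignType.sign (transitionMatrix x x' y).det *
      ∑ a, (transitionMatrix x x' y).adjugate i a * flux g u x' a (transition x x' y) := by
  have h : gradient g u x y i * (transitionMatrix x x' y).det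
      = ∑ a, (transitionMatrix x x' y).adjugate i a *
        gradient g u x' (transition x x' y) a := by
    have h1 := congrFun (congrArg (transitionMatrix x x' y).adjugate.mulVec
      (gradient_transition g hu hy)) i
    rw [Matrix.mulVec_mulVec, Matrix.adjugate_mul, Matrix.smul_mulVec, Matrix.one_mulVec] at h1
    rw [Pi.smul_apply, smul_eq_mul, mul_comm] at h1
    exact h1.symm
  rw [flux, sqrt_det_gram g hy, ← sign_mul_self (transitionMatrix x x' y).det]
  simp only [flux, mul_left_comm _ (√_) _, ← Finset.mul_sum]
  rw [← h]
  ring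

/-- The divergence of the flux transforms as a density at interior points: near such a point the
sign in `flux_transition` is constant, and the Piola identity applies. -/
theorem sum_pd_flux_transition (g : Metric n M) {u : M → ℝ}
    (hu : ContMDiff (𝓡∂ n) 𝓘(ℝ, ℝ) 2 u) {x x' : M} {y : Coord n} (hy : y ∈ overlap x x')
    (hy0 : 0 < y 0) :
    ∑ i, pd i (flux g u x i) y = |(transitionMatrix x x' y).det| *
      ∑ a, pd a (flux g u x' a) (transition x x' y) := by
  have hH : ∀ z : Coord n, 0 < z 0 → range (𝓡∂ n) ∈ nhds z := fun z hz ↦ by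
    rw [← mem_interior_iff_mem_nhds, interior_range_modelWithCornersEuclideanHalfSpace]
    exact hz
  have hty := transition_mem_overlap hy
  have hty0 : 0 < transition x x' y 0 :=
    lt_of_le_of_ne (mem_range_model.1 (mapsTo_transition x x' hy))
      fun h ↦ hy0.ne' ((transition_apply_zero_iff hy).1 h.symm)
  have hψ : ContDiffAt ℝ ∞ (transition x x') y :=
    (contDiffWithinAt_transition hy).contDiffAt (hH y hy0)
  have hJ : ∀ z : Coord n, 0 < z 0 → transitionMatrix x x' z = jacobian (transition x x') z :=
    fun z hz ↦ by rw [transitionMatrix, transitionDeriv, fderivWithin_of_mem_nhds (hH z hz)]; rfl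
  have hpos : ∀ᶠ z : Coord n in nhds y, 0 < z 0 :=
    (EuclideanSpace.proj (0 : Fin n) : Coord n →L[ℝ] ℝ).continuous.continuousAt.eventually
      (lt_mem_nhds hy0)
  have hov : ∀ᶠ z in nhds y, z ∈ overlap x x' := by
    have := overlap_mem_nhdsWithin hy
    rwa [nhdsWithin_eq_nhds.2 (hH y hy0)] at this
  have hd0 : (jacobian (transition x x') y).det ≠ 0 := by
    rw [← hJ y hy0]; exact det_transitionMatrix_ne_zero hy
  have hdetcont : ContinuousAt (fun z ↦ (jacobian (transition x x') z).det) y := by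
    have h1 : ∀ a i, ContDiffWithinAt ℝ 0 (fun z ↦ jacobian (transition x x') z a i) univ y := by
      intro a i
      have h2 : ContDiffAt ℝ 0 (fun z ↦ fderiv ℝ (transition x x') z
          (EuclideanSpace.single i 1)) y :=
        (hψ.fderiv_right (m := 0) (by simp)).clm_apply contDiffAt_const
      exact (contDiffAt_euclidean.1 h2 a).contDiffWithinAt
    have := (ContDiffWithinAt.matrix_det h1).continuousWithinAt
    rwa [continuousWithinAt_univ] at this
  have hsign : ∀ᶠ z in nhds y, SignType.sign (jacobian (transition x x') z).det
      = SignType.sign (jacobian (transition x x') y).det := by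
    have := (continuousAt_sign_of_ne_zero hd0).comp_of_eq hdetcont rfl
    exact (this.eventually (mem_nhds_discrete.2 rfl)).mono fun _ h ↦ h.symm
  set s : ℝ := ((SignType.sign (jacobian (transition x x') y).det : SignType) : ℝ) with hs
  have heq : ∀ i, flux g u x i =ᶠ[nhds y] fun z ↦ s * ∑ a,
      (jacobian (transition x x') z).adjugate i a * flux g u x' a (transition x x' z) := by
    intro i
    filter_upwards [hpos, hov, hsign] with z hz1 hz2 hz3
    rw [flux_transition g hu hz2, hJ z hz1, hz3]
  have hV : ∀ a, DifferentiableAt ℝ (flux g u x' a) (transition x x' y) := fun a ↦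
    ((contDiffWithinAt_flux g hu (mem_target_of_mem_overlap hty) a).differentiableWithinAt
      (by norm_num)).differentiableAt (hH _ hty0)
  have hpiola := sum_fderiv_adjugate_jacobian_mul (hψ.of_le ENat.LEInfty.out) hd0 hV
  simp only [pd_eq_fderiv hy0, pd_eq_fderiv hty0]
  rw [hJ y hy0, ← sign_mul_self (jacobian (transition x x') y).det, ← hs, mul_assoc, ← hpiola,
    Finset.mul_sum]
  refine Finset.sum_congr rfl fun i _ ↦ ?_
  rw [(heq i).fderiv_eq]
  exact congrArg (fun L : Coord n → Coord n →L[ℝ] ℝ ↦ L y (EuclideanSpace.single i 1))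
    (fderiv_const_smul_field s)

/-- At interior points the Laplacian may be computed in any chart. -/
theorem laplacian_symm (g : Metric n M) {u : M → ℝ} (hu : ContMDiff (𝓡∂ n) 𝓘(ℝ, ℝ) 2 u)
    {x : M} {y : Coord n} (hy : y ∈ (extChartAt (𝓡∂ n) x).target) (hy0 : 0 < y 0) :
    √(gram g x y).det * laplacian g u ((extChartAt (𝓡∂ n) x).symm y)
      = -∑ i, pd i (flux g u x i) y := by
  set q := (extChartAt (𝓡∂ n) x).symm y with hq
  have hov : y ∈ overlap x q := mem_overlap.2 ⟨hy, mem_extChartAt_source q⟩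
  have htr : transition x q y = extChartAt (𝓡∂ n) q q := rfl
  have hpos := det_gram_pos g (mem_target_of_mem_overlap (transition_mem_overlap hov))
  rw [laplacian_eq, ← htr, sum_pd_flux_transition g hu hov hy0, sqrt_det_gram g hov]
  have := (Real.sqrt_pos.2 hpos).ne'
  field_simp

theorem inv_gram_transition (g : Metric n M) {x x' : M} {y : Coord n} (hy : y ∈ overlap x x') :
    (gram g x' (transition x x' y))⁻¹ = transitionMatrix x x' y * (gram g x y)⁻¹ *
      (transitionMatrix x x' y).transpose := by
  have hdet : IsUnit (transitionMatrix x x' y).det := (det_transitionMatrix_ne_zero hy).isUnit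
  have hdet' : IsUnit (transitionMatrix x x' y).transpose.det := by
    rwa [Matrix.det_transpose]
  rw [gram_eq_transpose_mul g hy, Matrix.mul_inv_rev, Matrix.mul_inv_rev, ← Matrix.mul_assoc,
    Matrix.mul_nonsing_inv _ hdet, Matrix.one_mul, Matrix.mul_assoc,
    Matrix.nonsing_inv_mul _ hdet', Matrix.mul_one]

/-- Cramer's rule for the entry `g⁰⁰` of the inverse matrix. -/
theorem det_gramTan (g : Metric n M) {x : M} {y : Coord n}
    (hy : y ∈ (extChartAt (𝓡∂ n) x).target) :
    (gramTan g x y).det = (gram g x y)⁻¹ 0 0 * (gram g x y).det := by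
  have hdet := (det_gram_pos g hy).ne'
  have h1 : (gram g x y)⁻¹ 0 0 * (gram g x y).det = (gram g x y).adjugate 0 0 := by
    rw [Matrix.inv_def, Matrix.smul_apply, Ring.inverse_eq_inv', smul_eq_mul]
    field_simp
  rw [h1, gramTan]
  generalize gram g x y = A
  clear * -
  obtain ⟨m, rfl⟩ : ∃ m, n = m + 1 := ⟨n - 1, (Nat.succ_pred (NeZero.ne n)).symm⟩
  have h2 := Matrix.adjugate_fin_succ_eq_det_submatrix A 0 0
  have h3 := Matrix.det_submatrix_equiv_self
    (finSuccAboveEquiv (0 : Fin (m + 1))) (A.submatrix Subtype.val Subtype.val)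
  have h4 : (Subtype.val ∘ finSuccAboveEquiv (0 : Fin (m + 1))) = Fin.succ := by
    funext j
    exact congrFun Fin.succAbove_zero j
  rw [← h3, Matrix.submatrix_submatrix, h4]
  simpa using h2.symm

/-- At boundary points the normal derivative may be computed in any chart: `√(det g_{ab}) ∂_ν u`
is the flux through the hyperplane `y₀ = 0`. -/
theorem normalDeriv_symm (g : Metric n M) {u : M → ℝ} (hu : ContMDiff (𝓡∂ n) 𝓘(ℝ, ℝ) 2 u)
    {x : M} {y : Coord n} (hy : y ∈ (extChartAt (𝓡∂ n) x).target) (hy0 : y 0 = 0) :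
    √(gramTan g x y).det * normalDeriv g u ((extChartAt (𝓡∂ n) x).symm y)
      = -flux g u x 0 y := by
  set q := (extChartAt (𝓡∂ n) x).symm y with hq
  have hov : y ∈ overlap x q := mem_overlap.2 ⟨hy, mem_extChartAt_source q⟩
  have htr : transition x q y = extChartAt (𝓡∂ n) q q := rfl
  have hJ0 := transitionMatrix_zero_zero_pos hov hy0
  -- the row `J⁰` is `(J⁰₀, 0, …, 0)`, so `(∇u)⁰` scales by `J⁰₀` and `g⁰⁰` by its square
  have hrow : ∀ w : Fin n → ℝ, (transitionMatrix x q y).mulVec w 0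
      = transitionMatrix x q y 0 0 * w 0 := fun w ↦ by
    rw [Matrix.mulVec, dotProduct, Finset.sum_eq_single 0]
    · intro a _ ha; rw [transitionMatrix_zero_of_ne hov hy0 ha, zero_mul]
    · simp
  have hinv : (gram g q (transition x q y))⁻¹ 0 0
      = (transitionMatrix x q y 0 0) ^ 2 * (gram g x y)⁻¹ 0 0 := by
    rw [inv_gram_transition g hov, Matrix.mul_apply, Finset.sum_eq_single 0]
    · rw [Matrix.transpose_apply, Matrix.mul_apply, Finset.sum_eq_single 0]
      · ring
      · intro a _ ha; rw [transitionMatrix_zero_of_ne hov hy0 ha, zero_mul]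
      · simp
    · intro a _ ha
      rw [Matrix.transpose_apply, transitionMatrix_zero_of_ne hov hy0 ha, mul_zero]
    · simp
  have hpos : 0 < (gram g x y)⁻¹ 0 0 := (posDef_gram g hy).inv.diag_pos
  have hsq : √((gram g x y)⁻¹ 0 0) ≠ 0 := (Real.sqrt_pos.2 hpos).ne'
  rw [normalDeriv_eq_gradient, ← htr, gradient_transition g hu hov, hrow, hinv, det_gramTan g hy,
    Real.sqrt_mul hpos.le, Real.sqrt_mul (sq_nonneg _), Real.sqrt_sq hJ0.le, flux]
  have := hJ0.ne'
  field_simp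

/-! ### Linearity and locality -/

theorem gradient_sum (g : Metric n M) {ι : Type*} {s : Finset ι} {v : ι → M → ℝ}
    (hv : ∀ k ∈ s, ContMDiff (𝓡∂ n) 𝓘(ℝ, ℝ) 2 (v k)) {x : M} {y : Coord n}
    (hy : y ∈ (extChartAt (𝓡∂ n) x).target) (i : Fin n) :
    gradient g (fun q ↦ ∑ k ∈ s, v k q) x y i = ∑ k ∈ s, gradient g (v k) x y i := by
  simp only [gradient, Matrix.mulVec, dotProduct]
  rw [Finset.sum_comm]
  refine Finset.sum_congr rfl fun j _ ↦ ?_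
  rw [comp_sum_symm, pd_fun_sum (target_subset_range x hy) fun k hk ↦
    (contDiffWithinAt_comp_symm (k := 2) (hv k hk) hy).differentiableWithinAt (by norm_num),
    Finset.mul_sum]

theorem laplacian_sum (g : Metric n M) {ι : Type*} {s : Finset ι} {v : ι → M → ℝ}
    (hv : ∀ k ∈ s, ContMDiff (𝓡∂ n) 𝓘(ℝ, ℝ) 2 (v k)) (q : M) :
    laplacian g (fun q ↦ ∑ k ∈ s, v k q) q = ∑ k ∈ s, laplacian g (v k) q := by
  have hq := mem_extChartAt_target (I := 𝓡∂ n) q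
  have h : ∀ i, pd i (flux g (fun q ↦ ∑ k ∈ s, v k q) q i) (extChartAt (𝓡∂ n) q q)
      = ∑ k ∈ s, pd i (flux g (v k) q i) (extChartAt (𝓡∂ n) q q) := by
    intro i
    rw [← pd_fun_sum (target_subset_range q hq) fun k hk ↦
      (contDiffWithinAt_flux g (hv k hk) hq i).differentiableWithinAt (by norm_num)]
    refine pd_congr (target_subset_range q hq) ?_ i
    filter_upwards [target_mem_nhdsWithin hq] with z hz
    simp only [flux]
    rw [gradient_sum g hv hz, Finset.mul_sum]
  simp only [laplacian_eq, h]
  rw [Finset.sum_comm, Finset.mul_sum, Finset.sum_neg_distrib]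

theorem normalDeriv_sum (g : Metric n M) {ι : Type*} {s : Finset ι} {v : ι → M → ℝ}
    (hv : ∀ k ∈ s, ContMDiff (𝓡∂ n) 𝓘(ℝ, ℝ) 2 (v k)) (q : M) :
    normalDeriv g (fun q ↦ ∑ k ∈ s, v k q) q = ∑ k ∈ s, normalDeriv g (v k) q := by
  simp only [normalDeriv_eq_gradient]
  rw [gradient_sum g hv (mem_extChartAt_target q), Finset.sum_div, Finset.sum_neg_distrib]

theorem gradient_eq_zero (g : Metric n M) {v : M → ℝ} {x : M} {y : Coord n}
    (hy : y ∈ (extChartAt (𝓡∂ n) x).target)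
    (hv : (extChartAt (𝓡∂ n) x).symm y ∉ tsupport v) : gradient g v x y = 0 := by
  have h0 : v ∘ (extChartAt (𝓡∂ n) x).symm =ᶠ[nhdsWithin y (range (𝓡∂ n))] fun _ ↦ 0 := by
    have h1 := (continuousOn_extChartAt_symm x y hy).preimage_mem_nhdsWithin
      ((isClosed_tsupport v).isOpen_compl.mem_nhds hv)
    rw [nhdsWithin_extChartAt_target_eq_of_mem hy] at h1
    filter_upwards [h1] with z hz
    exact image_eq_zero_of_notMem_tsupport (f := v) hz
  have h2 : (fun j ↦ pd j (v ∘ (extChartAt (𝓡∂ n) x).symm) y) = 0 := by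
    funext j
    rw [pd_congr (target_subset_range x hy) h0, pd]
    simp
  rw [gradient, h2, Matrix.mulVec_zero]

theorem flux_eq_zero (g : Metric n M) {v : M → ℝ} {x : M} {y : Coord n}
    (hy : y ∈ (extChartAt (𝓡∂ n) x).target)
    (hv : (extChartAt (𝓡∂ n) x).symm y ∉ tsupport v) (i : Fin n) : flux g v x i y = 0 := by
  rw [flux, gradient_eq_zero g hy hv, Pi.zero_apply, mul_zero]

theorem laplacian_eq_zero (g : Metric n M) {v : M → ℝ} {q : M} (hq : q ∉ tsupport v) :
    laplacian g v q = 0 := by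
  have hqt := mem_extChartAt_target (I := 𝓡∂ n) q
  have h1 := (continuousOn_extChartAt_symm q _ hqt).preimage_mem_nhdsWithin
    ((isClosed_tsupport v).isOpen_compl.mem_nhds
      (by rwa [extChartAt_to_inv] : _ ∈ (tsupport v)ᶜ))
  rw [nhdsWithin_extChartAt_target_eq_of_mem hqt] at h1
  have h2 : ∀ i, pd i (flux g v q i) (extChartAt (𝓡∂ n) q q) = 0 := by
    intro i
    have h3 : flux g v q i =ᶠ[nhdsWithin (extChartAt (𝓡∂ n) q q) (range (𝓡∂ n))]
        fun _ ↦ 0 := by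
      filter_upwards [h1, target_mem_nhdsWithin hqt] with z hz1 hz2
      exact flux_eq_zero g hz2 hz1 i
    rw [pd_congr (target_subset_range q hqt) h3, pd]
    simp
  simp only [laplacian_eq, h2, Finset.sum_const_zero, mul_zero, neg_zero]

theorem normalDeriv_eq_zero (g : Metric n M) {v : M → ℝ} {q : M} (hq : q ∉ tsupport v) :
    normalDeriv g v q = 0 := by
  rw [normalDeriv_eq_gradient, gradient_eq_zero g (mem_extChartAt_target q)
    (by rwa [extChartAt_to_inv])]
  simp

end Gradient

/-! ### Green's formula -/

section Green

variable {n : ℕ} [NeZero n] {M : Type*} [TopologicalSpace M]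
  [ChartedSpace (EuclideanHalfSpace n) M]

theorem ae_zero_lt_apply_zero (x : M) :
    ∀ᵐ y : Coord n ∂(volume.restrict (extChartAt (𝓡∂ n) x).target), 0 < y 0 := by
  have h1 : volume (frontier (range (𝓡∂ n))) = 0 :=
    (𝓡∂ n).convex_range.addHaar_frontier volume
  have h2 : ∀ᵐ y : Coord n, y ∉ frontier (range (𝓡∂ n)) := measure_eq_zero_iff_ae_notMem.1 h1
  filter_upwards [ae_restrict_of_ae h2, ae_restrict_mem (measurableSet_target x)] with y hy1 hy2
  refine lt_of_le_of_ne (mem_range_model.1 (target_subset_range x hy2)) fun h ↦ hy1 ?_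
  rw [frontier_range_modelWithCornersEuclideanHalfSpace]
  exact h

variable [IsManifold (𝓡∂ n) ∞ M] [MeasurableSpace M] [BorelSpace M]

/-- Green's formula `∫ Δ v + ∫ ∂_ν v = 0` for functions supported in a chart. -/
theorem green_of_tsupport_subset [CompactSpace M] (g : Metric n M) {v : M → ℝ}
    (hv : ContMDiff (𝓡∂ n) 𝓘(ℝ, ℝ) 2 v) (x : M)
    (hsupp : tsupport v ⊆ (extChartAt (𝓡∂ n) x).source) :
    Integrable (laplacian g v) (volumeMeasure g) ∧
    IntegrableOn (normalDeriv g v) ((𝓡∂ n).boundary M) (boundaryMeasure g) ∧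
    ∫ q, laplacian g v q ∂(volumeMeasure g)
      + ∫ q in (𝓡∂ n).boundary M, normalDeriv g v q ∂(boundaryMeasure g) = 0 := by
  set φ := extChartAt (𝓡∂ n) x with hφ
  set K : Set (Coord n) := φ '' tsupport v with hK
  have hKc : IsCompact K := (isClosed_tsupport v).isCompact.image_of_continuousOn
    ((continuousOn_extChartAt x).mono hsupp)
  have hKt : K ⊆ φ.target := by
    rintro _ ⟨q, hq, rfl⟩
    exact φ.map_source (hsupp hq)
  have hKv : ∀ y ∈ φ.target, y ∉ K → φ.symm y ∉ tsupport v := fun y hy hyK h ↦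
    hyK ⟨φ.symm y, h, φ.right_inv hy⟩
  -- the flux, extended by zero to the half-space
  set F : Fin n → Coord n → ℝ := fun i ↦ φ.target.indicator (flux g v x i) with hF
  have hFt : ∀ i, ∀ y ∈ φ.target, F i y = flux g v x i y := fun i y hy ↦ indicator_of_mem hy _
  have hF0 : ∀ i, ∀ y ∉ K, F i y = 0 := by
    intro i y hy
    by_cases hyt : y ∈ φ.target
    · rw [hFt i y hyt]; exact flux_eq_zero g hyt (hKv y hyt hy) i
    · exact indicator_of_notMem hyt _
  have hFev : ∀ i, ∀ y ∈ φ.target, F i =ᶠ[nhdsWithin y (range (𝓡∂ n))] flux g v x i := by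
    intro i y hy
    filter_upwards [target_mem_nhdsWithin hy] with z hz using hFt i z hz
  have hFd : ∀ i, ContDiffOn ℝ 1 (F i) (range (𝓡∂ n)) := by
    intro i y hy
    by_cases hyK : y ∈ K
    · exact (contDiffWithinAt_flux g hv (hKt hyK) i).congr_of_eventuallyEq (hFev i y (hKt hyK))
        (hFt i y (hKt hyK))
    · refine contDiffWithinAt_const (c := (0 : ℝ)) |>.congr_of_eventuallyEq ?_ (hF0 i y hyK)
      filter_upwards [nhdsWithin_le_nhds (hKc.isClosed.isOpen_compl.mem_nhds hyK)] with z hz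
        using hF0 i z hz
  have hdivint := integrableOn_sum_pd hKc hFd hF0
  have hdiv := integral_sum_pd_eq_neg hKc hFd hF0
  have hdiv' : ∫ y in φ.target, ∑ i, pd i (F i) y = ∫ y in range (𝓡∂ n), ∑ i, pd i (F i) y := by
    refine (setIntegral_eq_of_subset_of_forall_sdiff_eq_zero
      (𝓡∂ n).isClosed_range.measurableSet (target_subset_range x) fun y hy ↦ ?_).symm
    exact Finset.sum_eq_zero fun i _ ↦ pd_eq_zero_of_notMem hKc.isClosed (hF0 i)
      (fun h ↦ hy.2 (hKt h)) i
  -- the interior term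
  have hvol : Integrable (laplacian g v) (chartVolume g x) ∧
      ∫ q, laplacian g v q ∂(chartVolume g x) = ∫ z, F 0 (bdryIncl z) := by
    have hae : ∀ᵐ y ∂(volume.restrict φ.target),
        √(gram g x y).det * laplacian g v (φ.symm y) = -∑ i, pd i (F i) y := by
      filter_upwards [ae_zero_lt_apply_zero x, ae_restrict_mem (measurableSet_target x)]
        with y hy0 hy
      rw [laplacian_symm g hv hy hy0]
      congr 1
      exact Finset.sum_congr rfl fun i _ ↦
        (pd_congr (target_subset_range x hy) (hFev i y hy) i).symm
    have h := integrable_paramMeasure (f := laplacian g v) (ρ := fun y ↦ √(gram g x y).det)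
      (measurableSet_target x) (continuousOn_extChartAt_symm x) (isOpen_source x).measurableSet
      φ.mapsTo_symm (continuousOn_extChartAt x) (fun y hy ↦ φ.right_inv hy)
      (fun q hq ↦ φ.left_inv hq)
      (Real.continuous_sqrt.comp_continuousOn
        (continuousOn_det fun i j ↦ (contDiffOn_gram g x i j).continuousOn))
      (fun y _ ↦ Real.sqrt_nonneg _)
      ((integrable_congr hae).2 (hdivint.mono_set (target_subset_range x)).neg)
    refine ⟨h.1, h.2.trans ?_⟩
    rw [integral_congr_ae hae, integral_neg, hdiv', hdiv, neg_neg]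
  -- the boundary term
  have hbdry : Integrable (normalDeriv g v) (chartArea g x) ∧
      ∫ q, normalDeriv g v q ∂(chartArea g x) = -∫ z, F 0 (bdryIncl z) := by
    have heq : ∀ z ∈ bdryIncl ⁻¹' φ.target,
        √(gramTan g x (bdryIncl z)).det * normalDeriv g v (φ.symm (bdryIncl z))
          = -F 0 (bdryIncl z) := fun z hz ↦ by
      rw [normalDeriv_symm g hv hz (bdryIncl_apply_zero z), hFt 0 _ hz]
    have hF0c : Continuous fun z ↦ F 0 (bdryIncl z) :=
      (hFd 0).continuousOn.comp_continuous continuous_bdryIncl bdryIncl_mem_range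
    have hcs : HasCompactSupport fun z ↦ F 0 (bdryIncl z) := by
      have hemb : Topology.IsClosedEmbedding (bdryIncl (n := n)) :=
        LinearMap.isClosedEmbedding_of_injective (f := (bdryInclL (n := n)).toLinearMap)
          (LinearMap.ker_eq_bot.2 bdryIncl_injective)
      exact HasCompactSupport.intro (hemb.isCompact_preimage hKc) fun z hz ↦ hF0 0 _ hz
    have hint : Integrable fun z ↦ F 0 (bdryIncl z) := hF0c.integrable_of_hasCompactSupport hcs
    have hmeas := measurableSet_bdryIncl_preimage_target (n := n) x
    have hres : MapsTo (fun z ↦ φ.symm (bdryIncl z)) (bdryIncl ⁻¹' φ.target)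
      (φ.source ∩ (𝓡∂ n).boundary M) := mapsTo_symm_comp_bdryIncl x
    have h := integrable_paramMeasure (f := normalDeriv g v)
      (ρ := fun z ↦ √(gramTan g x (bdryIncl z)).det)
      (Q := fun q (a : {i : Fin n // i ≠ 0}) ↦ φ q a)
      hmeas (continuousOn_symm_comp_bdryIncl x)
      ((isOpen_source x).measurableSet.inter measurableSet_boundary) hres
      (continuousOn_pi.2 fun a ↦ (EuclideanSpace.proj (a : Fin n) :
        Coord n →L[ℝ] ℝ).continuous.comp_continuousOn
          ((continuousOn_extChartAt x).mono inter_subset_left))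
      (fun z hz ↦ by
        funext a
        rw [φ.right_inv hz, bdryIncl_apply_coe])
      (fun q hq ↦ by
        have : bdryIncl (fun a : {i : Fin n // i ≠ 0} ↦ φ q a) = φ q := by
          ext i
          by_cases hi : i = 0
          · rw [hi, bdryIncl_apply_zero, (mem_boundary_iff hq.1).1 hq.2]
          · exact bdryIncl_apply_coe _ ⟨i, hi⟩
        rw [this, φ.left_inv hq.1])
      (Real.continuous_sqrt.comp_continuousOn
        (continuousOn_det fun i j ↦ (contDiffOn_gram g x i j).continuousOn.comp
          continuous_bdryIncl.continuousOn fun _ h ↦ h))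
      (fun y _ ↦ Real.sqrt_nonneg _)
      ((integrableOn_congr_fun heq hmeas).2 hint.neg.integrableOn)
    refine ⟨h.1, h.2.trans ?_⟩
    rw [setIntegral_congr_fun hmeas heq, integral_neg]
    exact congrArg Neg.neg (setIntegral_eq_integral_of_forall_compl_eq_zero
      fun z hz ↦ hF0 0 _ fun h ↦ hz (hKt h))
  -- from the chart domain to the manifold
  have hLsub : ∀ q ∉ φ.source, laplacian g v q = 0 := fun q hq ↦
    laplacian_eq_zero g fun h ↦ hq (hsupp h)
  have hNsub : ∀ q ∈ (𝓡∂ n).boundary M \ (φ.source ∩ (𝓡∂ n).boundary M),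
      normalDeriv g v q = 0 := fun q hq ↦
    normalDeriv_eq_zero g fun h ↦ hq.2 ⟨hsupp h, hq.1⟩
  rw [← volumeMeasure_restrict_source] at hvol
  rw [← boundaryMeasure_restrict_source] at hbdry
  refine ⟨?_, ?_, ?_⟩
  · exact IntegrableOn.integrable_of_forall_notMem_eq_zero hvol.1 hLsub
  · exact IntegrableOn.of_forall_sdiff_eq_zero hbdry.1 measurableSet_boundary hNsub
  · rw [← setIntegral_eq_integral_of_forall_compl_eq_zero hLsub, hvol.2,
      setIntegral_eq_of_subset_of_forall_sdiff_eq_zero measurableSet_boundary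
        inter_subset_right hNsub, hbdry.2]
    ring

/-- Green's formula `∫ Δ u + ∫ ∂_ν u = 0` on a compact manifold with boundary. -/
theorem green [CompactSpace M] [T2Space M] (g : Metric n M) {u : M → ℝ}
    (hu : ContMDiff (𝓡∂ n) 𝓘(ℝ, ℝ) 2 u) :
    Integrable (laplacian g u) (volumeMeasure g) ∧
    IntegrableOn (normalDeriv g u) ((𝓡∂ n).boundary M) (boundaryMeasure g) ∧
    ∫ q, laplacian g u q ∂(volumeMeasure g)
      + ∫ q in (𝓡∂ n).boundary M, normalDeriv g u q ∂(boundaryMeasure g) = 0 := by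
  obtain ⟨f, hf⟩ := SmoothPartitionOfUnity.exists_isSubordinate_chartAt_source (𝓡∂ n) M
  have hfin : {i | (Function.support (f i)).Nonempty}.Finite :=
    f.locallyFinite.finite_nonempty_of_compact
  set s := hfin.toFinset with hs
  set v : M → M → ℝ := fun i q ↦ f i q * u q with hv
  have hvd : ∀ i ∈ s, ContMDiff (𝓡∂ n) 𝓘(ℝ, ℝ) 2 (v i) := fun i _ ↦
    ((f i).contMDiff.of_le ENat.LEInfty.out).mul hu
  have hvs : ∀ i, tsupport (v i) ⊆ (extChartAt (𝓡∂ n) i).source := fun i ↦ by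
    rw [extChartAt_source]
    exact (tsupport_mul_subset_left (f := f i) (g := u)).trans (hf i)
  have hsum : u = fun q ↦ ∑ i ∈ s, v i q := by
    funext q
    have h1 : ∑ i ∈ s, f i q = 1 := by
      rw [← f.sum_eq_one (mem_univ q), finsum_eq_sum_of_support_subset]
      intro i hi
      rw [hs, Set.Finite.coe_toFinset]
      exact ⟨q, hi⟩
    rw [← Finset.sum_mul, h1, one_mul]
  have hgreen := fun i (hi : i ∈ s) ↦ green_of_tsupport_subset g (hvd i hi) i (hvs i)
  have hL : laplacian g u = fun q ↦ ∑ i ∈ s, laplacian g (v i) q := by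
    funext q
    conv_lhs => rw [hsum]
    exact laplacian_sum g hvd q
  have hN : normalDeriv g u = fun q ↦ ∑ i ∈ s, normalDeriv g (v i) q := by
    funext q
    conv_lhs => rw [hsum]
    exact normalDeriv_sum g hvd q
  rw [hL, hN]
  refine ⟨integrable_finsetSum _ fun i hi ↦ (hgreen i hi).1,
    integrable_finsetSum _ fun i hi ↦ (hgreen i hi).2.1, ?_⟩
  rw [integral_finsetSum _ fun i hi ↦ (hgreen i hi).1,
    integral_finsetSum _ fun i hi ↦ (hgreen i hi).2.1, ← Finset.sum_add_distrib]
  exact Finset.sum_eq_zero fun i hi ↦ (hgreen i hi).2.2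

end Green

end ConformalRobin

end

theorem theorem5p1 {n : ℕ} [NeZero n] (hn : 3 ≤ n)
    {M : Type*} [TopologicalSpace M] [T2Space M] [CompactSpace M]
    [ChartedSpace (EuclideanHalfSpace n) M] [IsManifold (𝓡∂ n) ∞ M]
    [MeasurableSpace M] [BorelSpace M]
    (g : ConformalRobin.Metric n M) (u : M → ℝ) (hu : u ∈ ConformalRobin.kerRobin g) :
    Integrable (fun x ↦ ConformalRobin.scalarCurvature g x * u x)
      (ConformalRobin.volumeMeasure g) ∧
    IntegrableOn (fun x ↦ ConformalRobin.meanCurvature g x * u x) ((𝓡∂ n).boundary M)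
      (ConformalRobin.boundaryMeasure g) ∧
    ((n : ℝ) - 2) / (4 * ((n : ℝ) - 1)) *
        ∫ x, ConformalRobin.scalarCurvature g x * u x ∂(ConformalRobin.volumeMeasure g) +
      ((n : ℝ) - 2) / (2 * ((n : ℝ) - 1)) *
        ∫ x in (𝓡∂ n).boundary M, ConformalRobin.meanCurvature g x * u x
          ∂(ConformalRobin.boundaryMeasure g) = 0 := by
  obtain ⟨hu2, hP, hB⟩ := hu
  have hn' : (3 : ℝ) ≤ n := by exact_mod_cast hn
  set c : ℝ := ((n : ℝ) - 2) / (4 * ((n : ℝ) - 1)) with hc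
  set c' : ℝ := ((n : ℝ) - 2) / (2 * ((n : ℝ) - 1)) with hc'
  have hc0 : c ≠ 0 := (div_pos (by linarith) (by linarith)).ne'
  have hc0' : c' ≠ 0 := (div_pos (by linarith) (by linarith)).ne'
  obtain ⟨hL, hN, hsum⟩ := ConformalRobin.green g hu2
  have hR : (fun x ↦ ConformalRobin.scalarCurvature g x * u x)
      = fun x ↦ -c⁻¹ * ConformalRobin.laplacian g u x := by
    funext x
    have h : ConformalRobin.laplacian g u x
        + c * ConformalRobin.scalarCurvature g x * u x = 0 := hP x
    field_simp
    linarith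
  have hH : EqOn (fun x ↦ ConformalRobin.meanCurvature g x * u x)
      (fun x ↦ -c'⁻¹ * ConformalRobin.normalDeriv g u x) ((𝓡∂ n).boundary M) := by
    intro x hx
    have h : ConformalRobin.normalDeriv g u x
        + c' * ConformalRobin.meanCurvature g x * u x = 0 := hB x hx
    simp only
    field_simp
    linarith
  have hm := ConformalRobin.measurableSet_boundary (n := n) (M := M)
  refine ⟨?_, ?_, ?_⟩
  · rw [hR]; exact hL.const_mul _
  · exact (integrableOn_congr_fun hH hm).2 (hN.const_mul _)
  · rw [hR, setIntegral_congr_fun hm hH, integral_const_mul, integral_const_mul]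
    field_simp
    linarith
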